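/- Let $0<\alpha<1$, $p,q,k\in\mathbb Z_{\ge 0}$, and consider the system $$\partial_t^\alpha u_s=E_s(t,x,u^{(k)}),\qquad s=1,\dots,q,\quad t>0,\ x\in\mathbb R^p,\tag{1}$$ where $u=(u_1,\dots,u_q)$ is a function of $(t,x)$, $u^{(k)}=(u_j^\theta)_{1\le j\le q,\ |\theta|\le k}$ with $u_j^\theta=\partial_x^\theta u_j$, $E$ is smooth (for $t>0$), and $\partial_t^\beta$ is the Riemann–Liouville derivative with base point $0$, $\partial_t^{\beta}w(t)=\frac1{\Gamma(n-\beta)}\frac{d^n}{dt^n}\int_0^t(t-s)^{n-\beta-1}w(s)\,ds$ for $n-1<\beta<n$. Split $E_s=H_s+F_s$ with $H_s(t,x)=E_s(t,x,0)$ (the terms free of $u$ and its $x$-derivatives), and split $F_s=\sum_{j,\theta}a_{s,j,\theta}(t,x)\,u_j^\theta+N_s$ into its linear terms, $a_{s,j,\theta}(t,x)=\frac{\partial F_s}{\partial u_j^\theta}(t,x,0)$, and the rest $N_s$. For a generator $X=\tau\partial_t+\sum_i\xi_i\partial_{x_i}+\sum_s\eta_s\partial_{u_s}$, with coefficients depending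 on $(t,x,u)$, put $Q_s=\eta_s-\tau\,\partial_tu_s-\sum_i\xi_i\,\partial_{x_i}u_s$ and $$\eta_s^\theta=D_\theta Q_s+\tau\,\partial_tu_s^\theta+\sum_i\xi_i\,\partial_{x_i}u_s^\theta,\qquad \eta_s^\alpha=D_t^\alpha Q_s+\tau\,\partial_t^{\alpha+1}u_s+\sum_i\xi_i\,\partial_t^\alpha\partial_{x_i}u_s ,$$ where $D_\theta$ and $D_t^\alpha$ are total derivatives, i.e. derivatives taken after inserting $u=u(t,x)$. $X$ is called a Lie symmetry of (1) if $\tau|_{t=0}=0$ and, for all $s$, $$\eta_s^\alpha-\tau\,\partial_tE_s-\sum_i\xi_i\,\partial_{x_i}E_s-\sum_{j}\sum_{|\theta|\le k}\eta_j^\theta\,\partial_{u_j^\theta}E_s=0$$ at all points of the (fractional) jet space that satisfy (1); that is, for every function $u$, smooth for $t>0$ and such that $u_s$, $\partial_{x_i}u_s$ and $Q_s$ (along $u$) are integrable near $t=0$, and every point $(t,x)$, $t>0$, at which $u$ satisfies (1). Let $X$ be of the form $$\tau=\chi_2t^2+\chi_1t,\quad \xi_i=\xi_i(x),\quad \eta_s=\big[g_s(x)+\gamma(2\chi_2t+\chi_1)\big]u_s+\sum_{i\ne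 s}f_{s,i}(x)u_i+h_s(t,x),$$ with constants $\chi_1,\chi_2$, with $\gamma=0$ if $\chi_2=0$ and $\gamma=\frac{\alpha-1}2$ if $\chi_2\neq0$, with smooth functions $\xi_i,g_s,f_{s,i}$ of $x$, and with functions $h_s$ that are smooth for $t>0$ and integrable in $t$ near $t=0$. Then $X$ is a Lie symmetry of (1) if and only if the following two conditions hold for $s=1,\dots,q$: the linear time-fractional system for the $h_s$, $$\partial_t^\alpha h_s+\sum_{i=1}^q\frac{\partial\eta_s}{\partial u_i}H_i-\alpha\,\tau'(t)H_s-\tau\,\frac{\partial H_s}{\partial t}-\sum_{i=1}^p\xi_i\frac{\partial H_s}{\partial x_i}-\sum_{j=1}^q\sum_{|\theta|\le k}a_{s,j,\theta}\,\partial_x^\theta h_j=0\qquad(t>0,\ x\in\mathbb R^p),$$ and the integer-order system, to hold identically in $t>0$, $x$, $u$ and the $x$-derivatives of $u$, $$\sum_{i=1}^q\frac{\partial\eta_s}{\partial u_i}F_i-\alpha\,\tau'(t)F_s-\tau\,\frac{\partial F_s}{\partial t}-\sum_{i=1}^p\xi_i\frac{\partial F_s}{\partial x_i}-\sum_{j=1}^q\sum_{|\theta|\le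 k}\big[\eta_j^\theta-\partial_x^\theta h_j\big]a_{s,j,\theta}-\sum_{j=1}^q\sum_{|\theta|\le k}\eta_j^\theta\,\frac{\partial N_s}{\partial u_j^\theta}=0 .$$ -/

import Mathlib

open scoped ContDiff

noncomputable section

namespace FracLie

/-! ### Fractional and integer-order derivatives -/

/-- Riemann–Liouville derivative of order `β > 0` with base point `0`, of a function of time:
with `n = ⌈β⌉`, it is the classical `n`-th derivative if `β = n`, and
`1 / Γ(n - β) * (d/dt)^n ∫_0^t (t - s)^(n - β - 1) f(s) ds` if `n - 1 < β < n`. -/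
def rlDeriv (β : ℝ) (f : ℝ → ℝ) (t : ℝ) : ℝ :=
  if β = (⌈β⌉₊ : ℝ) then iteratedDeriv ⌈β⌉₊ f t
  else (Real.Gamma ((⌈β⌉₊ : ℝ) - β))⁻¹ *
    iteratedDeriv ⌈β⌉₊
      (fun r => ∫ s in (0 : ℝ)..r, (r - s) ^ ((⌈β⌉₊ : ℝ) - β - 1) * f s) t

/-- The partial derivative `∂f/∂y_i` of a function of finitely many real variables. -/
def pd {ι : Type*} [DecidableEq ι] (i : ι) (f : (ι → ℝ) → ℝ) (y : ι → ℝ) : ℝ :=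
  lineDeriv ℝ f y (Pi.single i 1)

/-- `∂^{|θ|} f / ∂x_1^{θ_1} ⋯ ∂x_p^{θ_p}`. -/
def pdMulti {p : ℕ} (θ : Fin p → ℕ) (f : (Fin p → ℝ) → ℝ) : (Fin p → ℝ) → ℝ :=
  (List.finRange p).foldr (fun i F => (pd i)^[θ i] F) f

/-- Multi-indices `θ ∈ ℤ₊^p` with `|θ| ≤ k`. -/
abbrev MIdx (p k : ℕ) : Type := {θ : Fin p → Fin (k + 1) // ∑ i, (θ i : ℕ) ≤ k}

/-- The multi-index as a vector of natural numbers. -/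
def MIdx.toNat {p k : ℕ} (θ : MIdx p k) : Fin p → ℕ := fun i => (θ.1 i : ℕ)

/-- Values of the coordinates `u^{(k)} = (u_s^θ)`, `s = 1, …, q`, `|θ| ≤ k`. -/
abbrev Jet (p q k : ℕ) : Type := Fin q → MIdx p k → ℝ

/-- Vector functions `u(t, x)` with `q` components, of time and `p` space variables. -/
abbrev Fld (p q : ℕ) : Type := ℝ → (Fin p → ℝ) → Fin q → ℝ

/-- `u` is smooth on `t > 0`. -/
def SmoothFld {p q : ℕ} (u : Fld p q) : Prop :=
  ContDiffOn ℝ ∞ (fun P : ℝ × (Fin p → ℝ) => u P.1 P.2) (Set.Ioi 0 ×ˢ Set.univ)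

/-- The function `u_s^θ` of `(t, x)`. -/
def uTheta {p q : ℕ} (u : Fld p q) (s : Fin q) (θ : Fin p → ℕ) (t : ℝ) (x : Fin p → ℝ) : ℝ :=
  pdMulti θ (fun y => u t y s) x

/-- The point `u^{(k)}(t, x)`. -/
def jet {p q : ℕ} (k : ℕ) (u : Fld p q) (t : ℝ) (x : Fin p → ℝ) : Jet p q k :=
  fun s θ => uTheta u s θ.toNat t x

/-! ### The system and the splitting of its right-hand side -/

/-- Right-hand sides `E(t, x, u^{(k)})` of the systems `∂_t^α u = E(t, x, u^{(k)})`. -/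
abbrev Rhs (p q k : ℕ) : Type := ℝ → (Fin p → ℝ) → Jet p q k → Fin q → ℝ

/-- `E` is smooth on `t > 0`. -/
def SmoothRhs {p q k : ℕ} (E : Rhs p q k) : Prop :=
  ContDiffOn ℝ ∞ (fun P : ℝ × (Fin p → ℝ) × Jet p q k => E P.1 P.2.1 P.2.2)
    (Set.Ioi 0 ×ˢ Set.univ)

/-- `∂G_s / ∂u_j^θ` at the point `(t, x, z)`. -/
def jetPd {p q k : ℕ} (G : Rhs p q k) (s j : Fin q) (θ : MIdx p k)
    (t : ℝ) (x : Fin p → ℝ) (z : Jet p q k) : ℝ :=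
  lineDeriv ℝ (fun w => G t x w s) z (Pi.single j (Pi.single θ 1))

/-- `H(t, x)`: the part of `E` that is free of `u` and its derivatives. -/
def partH {p q k : ℕ} (E : Rhs p q k) (s : Fin q) (t : ℝ) (x : Fin p → ℝ) : ℝ := E t x 0 s

/-- `F = E - H`: the part of `E` that involves `u` and its derivatives. -/
def partF {p q k : ℕ} (E : Rhs p q k) : Rhs p q k := fun t x z s => E t x z s - partH E s t x

/-- The coefficient `a_{s,j,θ}(t, x)` of the linear term `a_{s,j,θ}(t, x) u_j^θ` of `F_s`
(zero when `F_s` has no term linear in `u_j^θ`). -/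
def linCoeff {p q k : ℕ} (E : Rhs p q k) (s j : Fin q) (θ : MIdx p k)
    (t : ℝ) (x : Fin p → ℝ) : ℝ :=
  jetPd (partF E) s j θ t x 0

/-- The terms of `F_s` that are not linear: `F_s` minus all its linear terms. -/
def partN {p q k : ℕ} (E : Rhs p q k) : Rhs p q k := fun t x z s =>
  partF E t x z s - ∑ j, ∑ θ, linCoeff E s j θ t x * z j θ

/-! ### Infinitesimal generators, prolongation and Lie symmetries -/

/-- The generator `τ ∂_t + ∑ ξ_i ∂_{x_i} + ∑ η_s ∂_{u_s}`, with coefficients depending on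
`(t, x, u)`. -/
structure Generator (p q : ℕ) where
  τ : ℝ → (Fin p → ℝ) → (Fin q → ℝ) → ℝ
  ξ : Fin p → ℝ → (Fin p → ℝ) → (Fin q → ℝ) → ℝ
  η : Fin q → ℝ → (Fin p → ℝ) → (Fin q → ℝ) → ℝ

/-- `η_s - τ ∂_t u_s - ∑ ξ_i ∂_{x_i} u_s` along the function `u`, as a function of `(t, x)`. -/
def charac {p q : ℕ} (X : Generator p q) (u : Fld p q) (s : Fin q)
    (t : ℝ) (x : Fin p → ℝ) : ℝ :=
  X.η s t x (u t x) - X.τ t x (u t x) * deriv (fun r => u r x s) t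
    - ∑ i, X.ξ i t x (u t x) * pd i (fun y => u t y s) x

/-- The extended infinitesimal
`η_s^θ = D_θ(η_s - τ ∂_t u_s - ∑ ξ_i ∂_{x_i} u_s) + τ ∂_t u_s^θ + ∑ ξ_i ∂_{x_i} u_s^θ`
along `u`: total `x`-derivatives are the derivatives after insertion of `u(t, x)`. -/
def etaTheta {p q : ℕ} (X : Generator p q) (u : Fld p q) (s : Fin q) (θ : Fin p → ℕ)
    (t : ℝ) (x : Fin p → ℝ) : ℝ :=
  pdMulti θ (fun y => charac X u s t y) x
    + X.τ t x (u t x) * deriv (fun r => uTheta u s θ r x) t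
    + ∑ i, X.ξ i t x (u t x) * pd i (fun y => uTheta u s θ t y) x

/-- For `θ = 0` the extended infinitesimal is `η_s` itself. -/
theorem etaTheta_zero {p q : ℕ} (X : Generator p q) (u : Fld p q) (s : Fin q)
    (t : ℝ) (x : Fin p → ℝ) :
    etaTheta X u s (fun _ => 0) t x = X.η s t x (u t x) := by
  have h : ∀ (l : List (Fin p)) (f : (Fin p → ℝ) → ℝ),
      l.foldr (fun i F => (pd i)^[0] F) f = f := by
    intro l f
    induction l with
    | nil => rfl
    | cons a l ih => simp
  simp only [etaTheta, uTheta, pdMulti, h, charac]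
  ring

/-- The extended infinitesimal of the fractional derivative,
`η_s^α = D_t^α(η_s - τ ∂_t u_s - ∑ ξ_i ∂_{x_i} u_s) + τ ∂_t^{α+1} u_s
  + ∑ ξ_i ∂_t^α ∂_{x_i} u_s`, along `u`. -/
def etaAlpha {p q : ℕ} (α : ℝ) (X : Generator p q) (u : Fld p q) (s : Fin q)
    (t : ℝ) (x : Fin p → ℝ) : ℝ :=
  rlDeriv α (fun r => charac X u s r x) t
    + X.τ t x (u t x) * rlDeriv (α + 1) (fun r => u r x s) t
    + ∑ i, X.ξ i t x (u t x) * rlDeriv α (fun r => pd i (fun y => u r y s) x) t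

/-- The prolonged generator applied to `∂_t^α u_s - E_s`, along `u` at `(t, x)`. The terms
`θ = 0` of the sum are `η_j ∂E_s/∂u_j`, by `etaTheta_zero`. -/
def prolong {p q k : ℕ} (α : ℝ) (E : Rhs p q k) (X : Generator p q) (u : Fld p q) (s : Fin q)
    (t : ℝ) (x : Fin p → ℝ) : ℝ :=
  etaAlpha α X u s t x
    - X.τ t x (u t x) * deriv (fun r => E r x (jet k u t x) s) t
    - ∑ i, X.ξ i t x (u t x) * pd i (fun y => E t y (jet k u t x) s) x
    - ∑ j, ∑ θ : MIdx p k, etaTheta X u j θ.toNat t x * jetPd E s j θ t x (jet k u t x)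

/-- Integrability on every `(0, T)`: what a function that is smooth
for `t > 0` needs in order to have Riemann–Liouville derivatives at every `t > 0`. -/
def RLIntegrable (f : ℝ → ℝ) : Prop :=
  ∀ T : ℝ, 0 < T → IntervalIntegrable f MeasureTheory.volume 0 T

/-- The functions on which the prolongation of `X` can be evaluated: smooth for `t > 0`, and all
functions whose fractional derivatives occur in `η_s^α` are integrable near `t = 0`. (They may
be singular at `t = 0`, for instance like `t ^ (α - 1)`.) -/
def Admissible {p q : ℕ} (X : Generator p q) (u : Fld p q) : Prop :=
  SmoothFld u ∧ ∀ (s : Fin q) (x : Fin p → ℝ),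
    RLIntegrable (fun r => u r x s) ∧
    (∀ i, RLIntegrable (fun r => pd i (fun y => u r y s) x)) ∧
    RLIntegrable (fun r => charac X u s r x)

/-- `X` is (the generator of) a Lie symmetry of `∂_t^α u = E(t, x, u^{(k)})`: it satisfies
`τ = 0` at `t = 0` and the infinitesimal invariance criterion, that the prolongation of `X`
annihilates `∂_t^α u - E` wherever `∂_t^α u - E = 0`. As usual the criterion is imposed at all
points of the (fractional) jet space that lie on the equation; every such point is represented by
a function `u` and a point `(t, x)` at which `u` satisfies the system. -/
def IsLieSymmetry {p q k : ℕ} (α : ℝ) (E : Rhs p q k) (X : Generator p q) : Prop :=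
  (∀ x v, X.τ 0 x v = 0) ∧
  ∀ u : Fld p q, Admissible X u → ∀ (t : ℝ) (x : Fin p → ℝ), 0 < t →
    (∀ s, rlDeriv α (fun r => u r x s) t = E t x (jet k u t x) s) →
    ∀ s, prolong α E X u s t x = 0

/-! ### Generators of the special form, and the two determining conditions -/

/-- `τ(t) = χ₂ t² + χ₁ t`. -/
def tau (χ₁ χ₂ : ℝ) (t : ℝ) : ℝ := χ₂ * t ^ 2 + χ₁ * t

/-- `γ = 0` if `χ₂ = 0`, and `γ = (α - 1) / 2` otherwise. -/
def gam (α χ₂ : ℝ) : ℝ := open Classical in if χ₂ = 0 then 0 else (α - 1) / 2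

/-- The generator with `τ = χ₂ t² + χ₁ t`, `ξ_i = ξ_i(x)` and
`η_s = [g_s(x) + γ (2 χ₂ t + χ₁)] u_s + ∑_{i ≠ s} f_{s,i}(x) u_i + h_s(t, x)`. -/
def specialGen {p q : ℕ} (α χ₁ χ₂ : ℝ) (ξ : Fin p → (Fin p → ℝ) → ℝ)
    (g : Fin q → (Fin p → ℝ) → ℝ) (f : Fin q → Fin q → (Fin p → ℝ) → ℝ)
    (h : Fld p q) : Generator p q where
  τ := fun t _ _ => tau χ₁ χ₂ t
  ξ := fun i _ x _ => ξ i x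
  η := fun s t x v =>
    (g s x + gam α χ₂ * (2 * χ₂ * t + χ₁)) * v s
      + ∑ i ∈ Finset.univ.erase s, f s i x * v i + h t x s

/-- `∂η_s/∂u_i` at `(t, x, v)`. -/
def etaU {p q : ℕ} (X : Generator p q) (s i : Fin q) (t : ℝ) (x : Fin p → ℝ)
    (v : Fin q → ℝ) : ℝ :=
  pd i (fun w => X.η s t x w) v

/-- The first determining condition, a linear time-fractional system for `h`:
`∂_t^α h_s + ∑_i ∂η_s/∂u_i H_i - α D_t(τ) H_s - τ ∂H_s/∂t - ∑_i ξ_i ∂H_s/∂x_i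
  - ∑ D_θ(h_j) ∂(a u_j^θ)/∂u_j^θ = 0`,
the last sum being over the linear terms `a u_j^θ` of `F_s`. -/
def FractionalCondition {p q k : ℕ} (α : ℝ) (E : Rhs p q k) (χ₁ χ₂ : ℝ)
    (ξ : Fin p → (Fin p → ℝ) → ℝ) (g : Fin q → (Fin p → ℝ) → ℝ)
    (f : Fin q → Fin q → (Fin p → ℝ) → ℝ) (h : Fld p q) : Prop :=
  ∀ (s : Fin q) (t : ℝ) (x : Fin p → ℝ) (v : Fin q → ℝ), 0 < t →
    rlDeriv α (fun r => h r x s) t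
      + ∑ i, etaU (specialGen α χ₁ χ₂ ξ g f h) s i t x v * partH E i t x
      - α * deriv (tau χ₁ χ₂) t * partH E s t x
      - tau χ₁ χ₂ t * deriv (fun r => partH E s r x) t
      - ∑ i, ξ i x * pd i (fun y => partH E s t y) x
      - ∑ j, ∑ θ : MIdx p k, uTheta h j θ.toNat t x * linCoeff E s j θ t x = 0

/-- The second determining condition, an integer-order system in `τ`, `ξ_i`, `η_s`:
`∑_i ∂η_s/∂u_i F_i - α D_t(τ) F_s - τ ∂F_s/∂t - ∑_i ξ_i ∂F_s/∂x_i
  - ∑ [η_j^θ - D_θ(h_j)] ∂(a u_j^θ)/∂u_j^θ - ∑ η_j^θ ∂N_s/∂u_j^θ = 0`,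
the first of the last two sums being over the linear terms `a u_j^θ` of `F_s`, and `N_s` being the
remaining terms of `F_s`. It is an identity in `(t, x)`, `u` and the `x`-derivatives of `u`, that
is, it holds for arbitrary smooth functions `u`. -/
def IntegerOrderCondition {p q k : ℕ} (α : ℝ) (E : Rhs p q k) (χ₁ χ₂ : ℝ)
    (ξ : Fin p → (Fin p → ℝ) → ℝ) (g : Fin q → (Fin p → ℝ) → ℝ)
    (f : Fin q → Fin q → (Fin p → ℝ) → ℝ) (h : Fld p q) : Prop :=
  ∀ u : Fld p q, SmoothFld u → ∀ (s : Fin q) (t : ℝ) (x : Fin p → ℝ), 0 < t →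
    ∑ i, etaU (specialGen α χ₁ χ₂ ξ g f h) s i t x (u t x) * partF E t x (jet k u t x) i
      - α * deriv (tau χ₁ χ₂) t * partF E t x (jet k u t x) s
      - tau χ₁ χ₂ t * deriv (fun r => partF E r x (jet k u t x) s) t
      - ∑ i, ξ i x * pd i (fun y => partF E t y (jet k u t x) s) x
      - ∑ j, ∑ θ : MIdx p k,
          (etaTheta (specialGen α χ₁ χ₂ ξ g f h) u j θ.toNat t x - uTheta h j θ.toNat t x)
            * linCoeff E s j θ t x
      - ∑ j, ∑ θ : MIdx p k,
          etaTheta (specialGen α χ₁ χ₂ ξ g f h) u j θ.toNat t x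
            * jetPd (partN E) s j θ t x (jet k u t x) = 0

end FracLie

end

noncomputable section

namespace FracLie

open MeasureTheory Set Filter Topology
open scoped Convolution

/-! ### The Riemann–Liouville integral -/

/-! For a generator of the special form, the Leibniz rule for the fractional derivative has no
infinite tail. Put `j = rlInt (-α) u`. Since multiplication by `s` inside the integral is
multiplication by `t` minus an integral of one order higher, all terms of `η_s^α` that come from the
quadratic `τ` can be written through `j` and its derivatives. The coefficient of undifferentiated
`j` is `α χ₂ (2γ + 1 - α)`, which the choice of `γ` makes zero (`gam_mul`). What is left
(`RLSmooth.deriv_rlInt_tau`, `etaAlpha_specialGen`) is a linear combination of the `∂_t^α u_i`, plus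
`∂_t^α h_s`.

At a point where the system holds, each `∂_t^α u_i` is replaced by `H_i + F_i`, and the prolongation
becomes `fracExpr + intExpr` (`prolong_specialGen`). The first summand does not involve `u`; the
second involves only the germ of `u` in time (`intExpr_congr`) and vanishes at `u = 0`
(`intExpr_zero`). The two determining conditions thus imply symmetry at once.

The converse rests on nonlocality. A bump placed strictly before `t₀` leaves the germ at `t₀`
unchanged but can give `∂_t^α u(t₀)` any value (`exists_rlDeriv_eq`), so every germ is realised by
an admissible function satisfying the system at the point (`exists_admissible_solution_at`). Hence
`fracExpr + intExpr = 0` for every smooth `u`; taking `u = 0` separates the summands.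

The analytic difficulty is that admissible functions may be singular at `t = 0`.
`RLSmooth.exists_split` gives the smoothness of the integrals, and `primitive_eq_of_linear_bound`
removes the boundary term of `τ u` at `0`. -/

/-- The convolution `∫_0^t (t - s)^β f(s) ds`. -/
def rlInt (β : ℝ) (f : ℝ → ℝ) (t : ℝ) : ℝ := ∫ s in (0 : ℝ)..t, (t - s) ^ β * f s

/-- Functions of time that are smooth for `t > 0` and integrable near `0`. -/
def RLSmooth (f : ℝ → ℝ) : Prop := ContDiffOn ℝ ∞ f (Ioi 0) ∧ RLIntegrable f

theorem exists_cutoff {g : ℝ → ℝ} (hg : ContDiffOn ℝ ∞ g (Ioi 0)) {a b : ℝ} (ha : 0 < a)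
    (hab : a < b) : ∃ G : ℝ → ℝ, ContDiff ℝ ∞ G ∧ HasCompactSupport G ∧ EqOn G g (Icc a b) ∧
      ∀ s ≤ a / 2, G s = 0 := by
  -- The inner ball is exactly `[a, b]`; the outer radius `b / 2` puts the left end of the support
  -- at `a / 2`, still inside `t > 0`.
  let φ : ContDiffBump ((a + b) / 2) :=
    ⟨(b - a) / 2, b / 2, by linarith, by linarith⟩
  have hφ0 : ∀ s ≤ a / 2, φ s = 0 := fun s hs => φ.zero_of_le_dist (by
    rw [Real.dist_eq, abs_of_nonpos (by linarith)]
    change b / 2 ≤ _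
    linarith)
  refine ⟨fun s => φ s * g s, ?_, φ.hasCompactSupport.mul_right, fun s hs => ?_,
    fun s hs => by simp [hφ0 s hs]⟩
  · rw [contDiff_iff_contDiffAt]
    intro s
    rcases lt_or_ge s (a / 2) with hs | hs
    · refine (contDiffAt_const (c := (0 : ℝ))).congr_of_eventuallyEq ?_
      filter_upwards [Iio_mem_nhds hs] with r hr
      rw [hφ0 r (le_of_lt hr), zero_mul]
    · exact φ.contDiff.contDiffAt.mul (hg.contDiffAt (Ioi_mem_nhds (by linarith)))
  · have : φ s = 1 := φ.one_of_mem_closedBall (by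
      rw [Metric.mem_closedBall, Real.dist_eq, abs_le]
      change -((b - a) / 2) ≤ _ ∧ _ ≤ (b - a) / 2
      constructor <;> linarith [hs.1, hs.2])
    simp [this]

theorem contDiffOn_rpow (β : ℝ) : ContDiffOn ℝ ∞ (fun r : ℝ => r ^ β) (Ioi 0) := fun _ hr =>
  (Real.contDiffAt_rpow_const_of_ne (ne_of_gt hr)).contDiffWithinAt

theorem rlKernel_integrable {β : ℝ} (hβ : -1 < β) (t : ℝ) :
    IntervalIntegrable (fun s => (t - s) ^ β) volume 0 t := by
  have := ((intervalIntegral.intervalIntegrable_rpow' hβ (a := 0) (b := t)).comp_sub_left t).symm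
  simpa using this

theorem rlInt_congr {β : ℝ} {f g : ℝ → ℝ} {t : ℝ} (ht : 0 ≤ t) (h : ∀ s ∈ Ioc 0 t, f s = g s) :
    rlInt β f t = rlInt β g t := by
  refine intervalIntegral.integral_congr_ae (ae_of_all _ fun s hs => ?_)
  rw [uIoc_of_le ht] at hs
  simp only [h s hs]

/-- The possible singularities sit at opposite ends: `f` at `0`, the kernel at `t`. On each half of
the interval one factor is continuous and the other integrable. -/
theorem RLSmooth.mul_kernel {β : ℝ} (hβ : -1 < β) {f : ℝ → ℝ} (hf : RLSmooth f) {t : ℝ}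
    (ht : 0 < t) : IntervalIntegrable (fun s => (t - s) ^ β * f s) volume 0 t := by
  refine IntervalIntegrable.trans (b := t / 2) ?_ ?_
  · refine (hf.2 (t / 2) (by linarith)).continuousOn_mul ?_
    rw [uIcc_of_le (by linarith)]
    intro s hs
    exact ((continuousAt_const.sub continuousAt_id).rpow_const
      (Or.inl (sub_pos.2 (show s < t by linarith [hs.2])).ne')).continuousWithinAt
  · refine IntervalIntegrable.mul_continuousOn ?_ ?_
    · refine (rlKernel_integrable hβ t).mono_set ?_
      rw [uIcc_of_le ht.le, uIcc_of_le (by linarith)]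
      exact Icc_subset_Icc_left (by linarith)
    · rw [uIcc_of_le (by linarith)]
      exact hf.1.continuousOn.mono fun s hs => lt_of_lt_of_le (by linarith) hs.1

theorem rlInt_add {β : ℝ} (hβ : -1 < β) {f g : ℝ → ℝ} (hf : RLSmooth f) (hg : RLSmooth g) {t : ℝ}
    (ht : 0 < t) : rlInt β (fun s => f s + g s) t = rlInt β f t + rlInt β g t := by
  unfold rlInt
  rw [← intervalIntegral.integral_add (hf.mul_kernel hβ ht) (hg.mul_kernel hβ ht)]
  simp only [mul_add]

theorem rlInt_const_mul (β c : ℝ) (f : ℝ → ℝ) (t : ℝ) :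
    rlInt β (fun s => c * f s) t = c * rlInt β f t := by
  unfold rlInt
  rw [← intervalIntegral.integral_const_mul]
  congr 1
  ext s
  ring

/-- Write `s = t - (t - s)`; the second term raises the exponent of the kernel by one. -/
theorem rlInt_id_mul {β : ℝ} (hβ : -1 < β) {f : ℝ → ℝ} (hf : RLSmooth f) {t : ℝ} (ht : 0 < t) :
    rlInt β (fun s => s * f s) t = t * rlInt β f t - rlInt (β + 1) f t := by
  unfold rlInt
  rw [← intervalIntegral.integral_const_mul, ← intervalIntegral.integral_sub
    ((hf.mul_kernel hβ ht).const_mul t) (hf.mul_kernel (by linarith) ht)]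
  refine intervalIntegral.integral_congr_ae ?_
  filter_upwards [Measure.ae_ne volume t] with s hst hs
  rw [uIoc_of_le ht.le] at hs
  have : 0 < t - s := sub_pos.2 (lt_of_le_of_ne hs.2 hst)
  rw [Real.rpow_add this, Real.rpow_one]
  ring

/-! ### Smoothness of the Riemann–Liouville integral -/

theorem locallyIntegrable_kernel {β : ℝ} (hβ : -1 < β) :
    LocallyIntegrable ((Ioi (0 : ℝ)).indicator fun r => r ^ β) volume := by
  rw [locallyIntegrable_iff]
  intro K hK
  obtain ⟨M, hM⟩ := hK.isBounded.subset_closedBall 0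
  refine IntegrableOn.mono_set ?_ hM
  rw [integrableOn_indicator_iff measurableSet_Ioi]
  have := (intervalIntegral.intervalIntegrable_rpow' hβ (a := 0) (b := |M|))
  rw [intervalIntegrable_iff_integrableOn_Ioc_of_le (abs_nonneg M)] at this
  refine this.mono_set fun s hs => ⟨hs.1, ?_⟩
  have := hs.2
  rw [Metric.mem_closedBall, Real.dist_eq, sub_zero] at this
  exact (le_abs_self s).trans (this.trans (le_abs_self M))

theorem rlInt_eq_kernel_convolution (β : ℝ) {f : ℝ → ℝ} (hf : ∀ s ≤ 0, f s = 0) {t : ℝ}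
    (ht : 0 ≤ t) : rlInt β f t =
      ((Ioi (0 : ℝ)).indicator (fun r => r ^ β) ⋆[ContinuousLinearMap.mul ℝ ℝ] f) t := by
  have h1 : rlInt β f t = ∫ r in (0 : ℝ)..t, r ^ β * f (t - r) := by
    have := intervalIntegral.integral_comp_sub_left (a := 0) (b := t)
      (fun r => r ^ β * f (t - r)) t
    simpa [rlInt] using this
  rw [h1, convolution_def, intervalIntegral.integral_of_le ht]
  refine Eq.trans ?_ (setIntegral_eq_integral_of_forall_compl_eq_zero (s := Ioc 0 t) ?_)
  · refine setIntegral_congr_fun measurableSet_Ioc fun r hr => ?_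
    simp [indicator_of_mem (show r ∈ Ioi (0 : ℝ) from hr.1)]
  · intro r hr
    by_cases h0 : 0 < r
    · have : f (t - r) = 0 := hf _ (by
        by_contra h
        exact hr ⟨h0, by linarith⟩)
      simp [this]
    · rw [indicator_of_notMem (show r ∉ Ioi (0 : ℝ) from h0)]
      simp

theorem rlInt_eq_convolution_of_support (β : ℝ) {f κ : ℝ → ℝ} {a b c : ℝ} (ha : 0 ≤ a)
    (hf : ∀ s ∉ Ioc 0 a, f s = 0) (hκ : EqOn κ (fun r => r ^ β) (Icc b c)) {t : ℝ}
    (hat : a + b ≤ t) (htc : t ≤ c) (hb : 0 ≤ b) :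
    rlInt β f t = (f ⋆[ContinuousLinearMap.mul ℝ ℝ] κ) t := by
  have h1 : ∀ s : ℝ, (Ioc 0 t).indicator (fun s => (t - s) ^ β * f s) s = f s * κ (t - s) := by
    intro s
    by_cases hs : s ∈ Ioc 0 a
    · rw [indicator_of_mem (show s ∈ Ioc 0 t from ⟨hs.1, by linarith [hs.2]⟩),
        hκ ⟨by linarith [hs.2], by linarith [hs.1]⟩, mul_comm]
    · by_cases hs' : s ∈ Ioc 0 t <;> simp [hf s hs]
  rw [rlInt, intervalIntegral.integral_of_le (by linarith), ← integral_indicator measurableSet_Ioc]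
  simp only [h1]
  rfl

/-- When `f` lives on `(0, a]` and `t` is near `t₀ > a`, the kernel is only evaluated away from its
singularity, so a smooth compactly supported `κ` can replace it. No bound on `β` is needed. -/
theorem exists_kernel_cutoff (β : ℝ) {f : ℝ → ℝ} {a t₀ : ℝ} (ha : 0 < a) (hat : a < t₀)
    (hf : ∀ s ∉ Ioc 0 a, f s = 0) : ∃ κ : ℝ → ℝ, ContDiff ℝ ∞ κ ∧ HasCompactSupport κ ∧
      EqOn κ (fun r => r ^ β) (Icc ((t₀ - a) / 2) (2 * t₀)) ∧
      rlInt β f =ᶠ[𝓝 t₀] (f ⋆[ContinuousLinearMap.mul ℝ ℝ] κ) := by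
  obtain ⟨κ, h1, h2, h3, -⟩ := exists_cutoff (contDiffOn_rpow β)
    (show 0 < (t₀ - a) / 2 by linarith) (show (t₀ - a) / 2 < 2 * t₀ by linarith)
  refine ⟨κ, h1, h2, h3, ?_⟩
  filter_upwards [Ioo_mem_nhds (show (t₀ + a) / 2 < t₀ by linarith)
    (show t₀ < 2 * t₀ by linarith)] with t ht
  exact rlInt_eq_convolution_of_support β ha.le hf h3 (by linarith [ht.1]) ht.2.le (by linarith)

theorem contDiffAt_rlInt_of_support (β : ℝ) {f : ℝ → ℝ} {a t₀ : ℝ} (ha : 0 < a) (hat : a < t₀)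
    (hf : ∀ s ∉ Ioc 0 a, f s = 0) (hfi : LocallyIntegrable f volume) :
    ContDiffAt ℝ ∞ (rlInt β f) t₀ := by
  obtain ⟨κ, h1, h2, -, h4⟩ := exists_kernel_cutoff β ha hat hf
  exact (h2.contDiff_convolution_right (n := ⊤) _ hfi h1).contDiffAt.congr_of_eventuallyEq h4

theorem hasDerivAt_rlInt_of_support (β : ℝ) {f : ℝ → ℝ} {a t₀ : ℝ} (ha : 0 < a) (hat : a < t₀)
    (hf : ∀ s ∉ Ioc 0 a, f s = 0) (hfi : LocallyIntegrable f volume) :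
    HasDerivAt (rlInt β f) (β * rlInt (β - 1) f t₀) t₀ := by
  obtain ⟨κ, h1, h2, h3, h4⟩ := exists_kernel_cutoff β ha hat hf
  have h5 := (h2.hasDerivAt_convolution_right (ContinuousLinearMap.mul ℝ ℝ) hfi
    (h1.of_le (by simp)) t₀).congr_of_eventuallyEq h4
  refine h5.congr_deriv ?_
  have h6 : ∀ s, f s * (β * (t₀ - s) ^ (β - 1)) = f s * deriv κ (t₀ - s) := by
    intro s
    by_cases hs : s ∈ Ioc 0 a
    · have h7 : κ =ᶠ[𝓝 (t₀ - s)] fun r => r ^ β := by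
        filter_upwards [Ioo_mem_nhds (show (t₀ - a) / 2 < t₀ - s by linarith [hs.2])
          (show t₀ - s < 2 * t₀ by linarith [hs.1])] with r hr
        exact h3 ⟨hr.1.le, hr.2.le⟩
      rw [h7.deriv_eq, Real.deriv_rpow_const]
    · simp [hf s hs]
  rw [convolution_def]
  simp only [ContinuousLinearMap.mul_apply', ← h6]
  rw [← setIntegral_eq_integral_of_forall_compl_eq_zero (s := Ioc 0 t₀), rlInt,
    intervalIntegral.integral_of_le (by linarith), ← integral_const_mul]
  · congr 1
    ext s
    ring
  · intro s hs
    rw [hf s fun h => hs ⟨h.1, by linarith [h.2]⟩, zero_mul]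

/-- Separates the two obstacles to smoothness at `t₀`: `f₁` may be singular at `0` but meets the
kernel where it is smooth, while `f₂` meets the singular kernel but is itself smooth. Each
convolution then has one smooth factor. -/
theorem RLSmooth.exists_split {f : ℝ → ℝ} (hf : RLSmooth f) {t₀ : ℝ} (ht₀ : 0 < t₀) :
    ∃ f₁ f₂ : ℝ → ℝ, LocallyIntegrable f₁ volume ∧ (∀ s ∉ Ioc 0 (t₀ / 2), f₁ s = 0) ∧
      ContDiff ℝ ∞ f₂ ∧ HasCompactSupport f₂ ∧ (∀ s ≤ t₀ / 4, f₂ s = 0) ∧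
      ∀ s ∈ Ioc 0 (2 * t₀), f s = f₁ s + f₂ s := by
  obtain ⟨f₂, h1, h2, h3, h4⟩ := exists_cutoff hf.1 (show 0 < t₀ / 2 by linarith)
    (show t₀ / 2 < 2 * t₀ by linarith)
  refine ⟨(Ioc 0 (t₀ / 2)).indicator fun s => f s - f₂ s, f₂, ?_, fun s hs => indicator_of_notMem hs _,
    h1, h2, fun s hs => h4 s (by linarith), fun s hs => ?_⟩
  · refine Integrable.locallyIntegrable ?_
    rw [integrable_indicator_iff measurableSet_Ioc]
    have := (hf.2 (t₀ / 2) (by linarith)).sub (h1.continuous.intervalIntegrable 0 (t₀ / 2))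
    rwa [intervalIntegrable_iff_integrableOn_Ioc_of_le (by linarith)] at this
  · by_cases h : s ≤ t₀ / 2
    · rw [indicator_of_mem (show s ∈ Ioc 0 (t₀ / 2) from ⟨hs.1, h⟩)]
      ring
    · rw [indicator_of_notMem (fun h' => h h'.2), zero_add, h3 ⟨by linarith, hs.2⟩]

theorem RLSmooth.of_contDiff {f : ℝ → ℝ} (hf : ContDiff ℝ ∞ f) : RLSmooth f :=
  ⟨hf.contDiffOn, fun _ _ => hf.continuous.intervalIntegrable _ _⟩

theorem RLSmooth.of_eq_zero_near {f : ℝ → ℝ} (hf : ContDiffOn ℝ ∞ f (Ioi 0)) {ε : ℝ}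
    (hε : 0 < ε) (h0 : ∀ s ∈ Ioc 0 ε, f s = 0) : RLSmooth f := by
  have h1 : IntervalIntegrable f volume 0 ε := by
    refine (intervalIntegrable_const (c := (0 : ℝ))).congr fun s hs => ?_
    rw [uIoc_of_le hε.le] at hs
    exact (h0 s hs).symm
  refine ⟨hf, fun T hT => h1.trans (ContinuousOn.intervalIntegrable ?_)⟩
  exact hf.continuousOn.mono fun s hs => lt_of_lt_of_le (lt_min hε hT) hs.1

theorem RLSmooth.add {f g : ℝ → ℝ} (hf : RLSmooth f) (hg : RLSmooth g) :
    RLSmooth fun s => f s + g s :=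
  ⟨hf.1.add hg.1, fun T hT => (hf.2 T hT).add (hg.2 T hT)⟩

theorem RLSmooth.sub {f g : ℝ → ℝ} (hf : RLSmooth f) (hg : RLSmooth g) :
    RLSmooth fun s => f s - g s :=
  ⟨hf.1.sub hg.1, fun T hT => (hf.2 T hT).sub (hg.2 T hT)⟩

theorem RLSmooth.smooth_mul {f φ : ℝ → ℝ} (hφ : ContDiff ℝ ∞ φ) (hf : RLSmooth f) :
    RLSmooth fun s => φ s * f s :=
  ⟨hφ.contDiffOn.mul hf.1, fun T hT => (hf.2 T hT).continuousOn_mul hφ.continuous.continuousOn⟩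

theorem RLSmooth.const_mul {f : ℝ → ℝ} (c : ℝ) (hf : RLSmooth f) : RLSmooth fun s => c * f s :=
  hf.smooth_mul contDiff_const

theorem RLSmooth.zero : RLSmooth fun _ => 0 := .of_contDiff contDiff_const

theorem RLSmooth.sum {ι : Type*} {F : Finset ι} {f : ι → ℝ → ℝ} (hf : ∀ i ∈ F, RLSmooth (f i)) :
    RLSmooth fun s => ∑ i ∈ F, f i s := by
  classical
  induction F using Finset.induction_on with
  | empty => simpa using RLSmooth.zero
  | insert a F ha ih =>
    simp only [Finset.sum_insert ha]
    exact (hf a (by simp)).add (ih fun i hi => hf i (by simp [hi]))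

theorem rlInt_sub {β : ℝ} (hβ : -1 < β) {f g : ℝ → ℝ} (hf : RLSmooth f) (hg : RLSmooth g) {t : ℝ}
    (ht : 0 < t) : rlInt β (fun s => f s - g s) t = rlInt β f t - rlInt β g t := by
  unfold rlInt
  rw [← intervalIntegral.integral_sub (hf.mul_kernel hβ ht) (hg.mul_kernel hβ ht)]
  simp only [mul_sub]

theorem rlInt_split {β : ℝ} (hβ : -1 < β) {f f₁ f₂ : ℝ → ℝ} (hf : RLSmooth f) {t₀ : ℝ}
    (ht₀ : 0 < t₀) (h₂ : ContDiff ℝ ∞ f₂) (h : ∀ s ∈ Ioc 0 (2 * t₀), f s = f₁ s + f₂ s) :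
    rlInt β f =ᶠ[𝓝 t₀] fun t => rlInt β f₁ t + rlInt β f₂ t := by
  filter_upwards [Ioo_mem_nhds ht₀ (show t₀ < 2 * t₀ by linarith)] with t ht
  have h1 : rlInt β f₁ t = rlInt β (fun s => f s - f₂ s) t :=
    rlInt_congr ht.1.le fun s hs => by
      rw [h s ⟨hs.1, hs.2.trans ht.2.le⟩]
      ring
  rw [h1, rlInt_sub hβ hf (.of_contDiff h₂) ht.1]
  ring

theorem RLSmooth.contDiffAt_rlInt {β : ℝ} (hβ : -1 < β) {f : ℝ → ℝ} (hf : RLSmooth f) {t₀ : ℝ}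
    (ht₀ : 0 < t₀) : ContDiffAt ℝ ∞ (rlInt β f) t₀ := by
  obtain ⟨f₁, f₂, h1, h2, h3, h4, h5, h6⟩ := hf.exists_split ht₀
  refine ContDiffAt.congr_of_eventuallyEq ?_ (rlInt_split hβ hf ht₀ h3 h6)
  refine (contDiffAt_rlInt_of_support β (half_pos ht₀) (half_lt_self ht₀) h2 h1).add ?_
  refine (h4.contDiff_convolution_right (n := ⊤) (ContinuousLinearMap.mul ℝ ℝ)
    (locallyIntegrable_kernel hβ) h3).contDiffAt.congr_of_eventuallyEq ?_
  filter_upwards [Ioi_mem_nhds ht₀] with t ht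
  exact rlInt_eq_kernel_convolution β (fun s hs => h5 s (by linarith)) (le_of_lt ht)

theorem RLSmooth.differentiableAt_rlInt {β : ℝ} (hβ : -1 < β) {f : ℝ → ℝ} (hf : RLSmooth f) {t : ℝ}
    (ht : 0 < t) : DifferentiableAt ℝ (rlInt β f) t :=
  (hf.contDiffAt_rlInt hβ ht).differentiableAt (by simp)

theorem RLSmooth.hasDerivAt_primitive {f : ℝ → ℝ} (hf : RLSmooth f) {t : ℝ} (ht : 0 < t) :
    HasDerivAt (fun s => ∫ r in (0 : ℝ)..s, f r) (f t) t :=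
  intervalIntegral.integral_hasDerivAt_right (hf.2 t ht)
    (hf.1.continuousOn.stronglyMeasurableAtFilter isOpen_Ioi t ht)
    (hf.1.continuousOn.continuousAt (Ioi_mem_nhds ht))

theorem RLSmooth.continuousOn_primitive {f : ℝ → ℝ} (hf : RLSmooth f) {t : ℝ} (ht : 0 < t) :
    ContinuousOn (fun s => ∫ r in (0 : ℝ)..s, f r) (uIcc 0 t) :=
  intervalIntegral.continuousOn_primitive_interval' (hf.2 t ht) left_mem_uIcc

/-- Integration by parts: the kernel of exponent `β + 1 > 0` vanishes at `s = t` and the primitive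
at `s = 0`, so there is no boundary term. -/
theorem RLSmooth.rlInt_primitive {β : ℝ} (hβ : -1 < β) {f : ℝ → ℝ} (hf : RLSmooth f) {t : ℝ}
    (ht : 0 < t) :
    rlInt (β + 1) f t = (β + 1) * rlInt β (fun s => ∫ r in (0 : ℝ)..s, f r) t := by
  have h := intervalIntegral.integral_mul_deriv_eq_deriv_mul_of_hasDerivAt (a := 0) (b := t)
    (u := fun s => (t - s) ^ (β + 1)) (u' := fun s => -((β + 1) * (t - s) ^ β))
    (v := fun s => ∫ r in (0 : ℝ)..s, f r) (v' := f)
    (fun s _ => ((continuousAt_const.sub continuousAt_id).rpow_const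
      (Or.inr (by linarith))).continuousWithinAt) (hf.continuousOn_primitive ht) ?_ ?_
    ((rlKernel_integrable hβ t).const_mul _).neg (hf.2 t ht)
  · rw [rlInt, h]
    simp only [sub_self, Real.zero_rpow (show β + 1 ≠ 0 by linarith),
      intervalIntegral.integral_same, neg_mul, intervalIntegral.integral_neg, mul_assoc,
      intervalIntegral.integral_const_mul]
    rw [rlInt]
    ring
  · intro s hs
    rw [min_eq_left ht.le, max_eq_right ht.le] at hs
    have h1 := ((hasDerivAt_id s).const_sub t).rpow_const (p := β + 1)
      (Or.inl (sub_pos.2 hs.2).ne')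
    refine h1.congr_deriv ?_
    simp only [id, add_sub_cancel_right]
    ring
  · intro s hs
    rw [min_eq_left ht.le] at hs
    exact hf.hasDerivAt_primitive hs.1

theorem RLSmooth.hasDerivAt_rlInt_succ {β : ℝ} (hβ : -1 < β) {f : ℝ → ℝ} (hf : RLSmooth f) {t₀ : ℝ}
    (ht₀ : 0 < t₀) : HasDerivAt (rlInt (β + 1) f) ((β + 1) * rlInt β f t₀) t₀ := by
  obtain ⟨f₁, f₂, h1, h2, h3, h4, h5, h6⟩ := hf.exists_split ht₀
  have h7 := hasDerivAt_rlInt_of_support (β + 1) (half_pos ht₀) (half_lt_self ht₀) h2 h1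
  have h8 : HasDerivAt (rlInt (β + 1) f₂) ((β + 1) * rlInt β f₂ t₀) t₀ := by
    -- Here the derivative must fall on `f₂`, the kernel being singular at `t₀`; integration by
    -- parts then brings it back to `f₂`.
    have h9 := h4.hasDerivAt_convolution_right (ContinuousLinearMap.mul ℝ ℝ)
      (locallyIntegrable_kernel (show -1 < β + 1 by linarith)) (h3.of_le (by simp)) t₀
    have h10 : ∀ s ≤ 0, deriv f₂ s = 0 := fun s hs => by
      have : f₂ =ᶠ[𝓝 s] fun _ => 0 := by
        filter_upwards [Iio_mem_nhds (show s < t₀ / 4 by linarith)] with r hr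
        exact h5 r (le_of_lt hr)
      rw [this.deriv_eq, deriv_const]
    have h11 : ContDiff ℝ ∞ (deriv f₂) := (contDiff_infty_iff_deriv.1 h3).2
    rw [← rlInt_eq_kernel_convolution _ h10 ht₀.le,
      (RLSmooth.of_contDiff h11).rlInt_primitive hβ ht₀] at h9
    have h12 : ∀ s, ∫ r in (0 : ℝ)..s, deriv f₂ r = f₂ s := fun s => by
      rw [intervalIntegral.integral_deriv_eq_sub
        (fun r _ => (h3.differentiable (by simp)).differentiableAt)
        (h11.continuous.intervalIntegrable _ _), h5 0 (by linarith), sub_zero]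
    simp only [h12] at h9
    refine h9.congr_of_eventuallyEq ?_
    filter_upwards [Ioi_mem_nhds ht₀] with t ht
    exact rlInt_eq_kernel_convolution _ (fun s hs => h5 s (by linarith)) (le_of_lt ht)
  refine ((h7.add h8).congr_of_eventuallyEq
    (rlInt_split (by linarith) hf ht₀ h3 h6)).congr_deriv ?_
  rw [add_sub_cancel_right, (rlInt_split hβ hf ht₀ h3 h6).eq_of_nhds]
  ring

theorem RLSmooth.hasDerivAt_rlInt_primitive {β : ℝ} (hβ : -1 < β) {f : ℝ → ℝ} (hf : RLSmooth f)
    {t : ℝ} (ht : 0 < t) :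
    HasDerivAt (rlInt β fun s => ∫ r in (0 : ℝ)..s, f r) (rlInt β f t) t := by
  have hne : β + 1 ≠ 0 := by linarith
  refine (((hf.hasDerivAt_rlInt_succ hβ ht).const_mul (β + 1)⁻¹).congr_deriv
    (by field_simp)).congr_of_eventuallyEq ?_
  filter_upwards [Ioi_mem_nhds ht] with s hs
  rw [hf.rlInt_primitive hβ hs]
  field_simp

theorem RLSmooth.hasDerivAt_rlInt_id_mul {β : ℝ} (hβ : -1 < β) {f : ℝ → ℝ} (hf : RLSmooth f)
    {t : ℝ} (ht : 0 < t) : HasDerivAt (rlInt β fun s => s * f s)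
      (t * deriv (rlInt β f) t - β * rlInt β f t) t := by
  have h1 := (((hasDerivAt_id t).mul (hf.differentiableAt_rlInt hβ ht).hasDerivAt).sub
    (hf.hasDerivAt_rlInt_succ hβ ht)).congr_deriv
    (show _ = t * deriv (rlInt β f) t - β * rlInt β f t by simp only [id]; ring)
  refine h1.congr_of_eventuallyEq ?_
  filter_upwards [Ioi_mem_nhds ht] with s hs
  exact rlInt_id_mul hβ hf hs

/-! ### The fractional derivative along a quadratic time vector field -/

theorem contDiff_tau (χ₁ χ₂ : ℝ) : ContDiff ℝ ∞ (tau χ₁ χ₂) := by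
  unfold tau
  fun_prop

theorem hasDerivAt_tau (χ₁ χ₂ t : ℝ) : HasDerivAt (tau χ₁ χ₂) (2 * χ₂ * t + χ₁) t := by
  have := ((hasDerivAt_pow 2 t).const_mul χ₂).add ((hasDerivAt_id t).const_mul χ₁)
  refine this.congr_deriv ?_
  simp
  ring

theorem deriv_tau (χ₁ χ₂ t : ℝ) : deriv (tau χ₁ χ₂) t = 2 * χ₂ * t + χ₁ :=
  (hasDerivAt_tau χ₁ χ₂ t).deriv

theorem contDiffOn_deriv {f : ℝ → ℝ} (hf : ContDiffOn ℝ ∞ f (Ioi 0)) :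
    ContDiffOn ℝ ∞ (deriv f) (Ioi 0) :=
  ((contDiffOn_infty_iff_deriv_of_isOpen isOpen_Ioi).1 hf).2

theorem hasDerivAt_of_contDiffOn {f : ℝ → ℝ} (hf : ContDiffOn ℝ ∞ f (Ioi 0)) {t : ℝ}
    (ht : 0 < t) : HasDerivAt f (deriv f t) t :=
  ((hf.contDiffAt (Ioi_mem_nhds ht)).differentiableAt (by simp)).hasDerivAt

/-- If `u` and `(φ u)'` are integrable near `0`, where `φ = O(t)`, then `φ u` vanishes at `0`. -/
theorem primitive_eq_of_linear_bound {φ u w' : ℝ → ℝ} {C : ℝ}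
    (hφ : ∀ t ∈ Ioo (0 : ℝ) 1, |φ t| ≤ C * t) (hu : RLIntegrable u) (hw' : RLSmooth w')
    (hd : ∀ t, 0 < t → HasDerivAt (fun s => φ s * u s) (w' t) t) {t : ℝ} (ht : 0 < t) :
    ∫ s in (0 : ℝ)..t, w' s = φ t * u t := by
  set L := φ t * u t - ∫ s in (0 : ℝ)..t, w' s with hL
  -- The defect `L` does not depend on `t`, so it is the limit of `φ u` at `0`. If it were nonzero,
  -- `|u|` would dominate a multiple of `1 / r` near `0`, against integrability.
  have h1 : ∀ r, 0 < r → φ r * u r = L + ∫ s in (0 : ℝ)..r, w' s := by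
    intro r hr
    have h2 : ∫ s in t..r, w' s = φ r * u r - φ t * u t := by
      refine intervalIntegral.integral_eq_sub_of_hasDerivAt (f := fun s => φ s * u s)
        (fun s hs => hd s ?_) ?_
      · exact lt_of_lt_of_le (lt_min ht hr) hs.1
      · exact (hw'.2 t ht).symm.trans (hw'.2 r hr)
    rw [← intervalIntegral.integral_interval_sub_left (hw'.2 r hr) (hw'.2 t ht)] at h2
    rw [hL]
    linarith
  by_contra hne
  have hL0 : L ≠ 0 := fun h => hne (by linarith)
  have hC : 0 ≤ C := by
    have := (abs_nonneg _).trans (hφ (1 / 2) ⟨by norm_num, by norm_num⟩)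
    linarith
  have h3 : Tendsto (fun r => ∫ s in (0 : ℝ)..r, w' s) (𝓝[>] 0) (𝓝 0) := by
    have := (hw'.continuousOn_primitive one_pos) 0 left_mem_uIcc
    rw [ContinuousWithinAt, intervalIntegral.integral_same, uIcc_of_le zero_le_one] at this
    exact this.mono_left (nhdsWithin_le_of_mem (Icc_mem_nhdsGT one_pos))
  have h4 : ∀ᶠ r in 𝓝[>] (0 : ℝ), |∫ s in (0 : ℝ)..r, w' s| < |L| / 2 := by
    have := h3.abs
    rw [abs_zero] at this
    exact this.eventually_lt_const (by positivity)
  obtain ⟨δ, hδ, h5⟩ := mem_nhdsGT_iff_exists_Ioo_subset.1 h4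
  set ε := min δ 1 / 2 with hε
  have hmin : 0 < min δ 1 := lt_min hδ one_pos
  have hε0 : 0 < ε := by positivity
  have h6 : IntervalIntegrable (fun r : ℝ => r⁻¹) volume 0 ε := by
    refine ((hu ε hε0).const_mul (2 * C / |L|)).mono_fun
      measurable_inv.aestronglyMeasurable ?_
    rw [uIoc_of_le hε0.le]
    refine (ae_restrict_iff' measurableSet_Ioc).2 (ae_of_all _ fun r hr => ?_)
    have hr1 : r < min δ 1 := lt_of_le_of_lt hr.2 (half_lt_self hmin)
    have h7 : |∫ s in (0 : ℝ)..r, w' s| < |L| / 2 := h5 ⟨hr.1, hr1.trans_le (min_le_left _ _)⟩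
    have h8 := h1 r hr.1
    have h9 := hφ r ⟨hr.1, hr1.trans_le (min_le_right _ _)⟩
    have h10 : |L| / 2 ≤ |φ r| * |u r| := by
      rw [← abs_mul, h8]
      have := abs_sub_abs_le_abs_sub L (-∫ s in (0 : ℝ)..r, w' s)
      rw [abs_neg, sub_neg_eq_add] at this
      linarith
    have h11 : |L| / 2 ≤ C * r * |u r| :=
      h10.trans (mul_le_mul_of_nonneg_right h9 (abs_nonneg _))
    have hLpos : 0 < |L| := abs_pos.2 hL0
    change |r⁻¹| ≤ |2 * C / |L| * u r|
    rw [abs_inv, abs_of_pos hr.1, abs_mul,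
      abs_of_nonneg (show 0 ≤ 2 * C / |L| by positivity), inv_le_iff_one_le_mul₀ hr.1]
    rw [div_mul_eq_mul_div, div_mul_eq_mul_div, le_div_iff₀ hLpos]
    linarith
  rw [intervalIntegrable_inv_iff] at h6
  rcases h6 with h6 | h6
  · exact hε0.ne h6
  · exact h6 left_mem_uIcc

/-- The only property of `γ` that the Leibniz rule uses. -/
theorem gam_mul (α χ₂ : ℝ) : χ₂ * (2 * gam α χ₂ + 1 - α) = 0 := by
  unfold gam
  split_ifs with h
  · simp [h]
  · ring

/-- As `τ u` vanishes at `0`, it is the primitive of `τ' u + τ u'`, so the integral of `τ u'` is the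
derivative of the integral of `τ u` minus the integral of `τ' u`. Both are expressed through `j` and
`j1`, the integrals of `u` and `s u`; the final differentiation turns `j1` into `t j' + α j`. -/
theorem RLSmooth.deriv_rlInt_tau {α : ℝ} (hα1 : α < 1) {u : ℝ → ℝ} (hu : RLSmooth u) {χ₁ χ₂ : ℝ}
    (hτ : RLIntegrable fun s => tau χ₁ χ₂ s * deriv u s) {t : ℝ} (ht : 0 < t) :
    gam α χ₂ * deriv (rlInt (-α) fun s => (2 * χ₂ * s + χ₁) * u s) t
      - deriv (rlInt (-α) fun s => tau χ₁ χ₂ s * deriv u s) t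
      + tau χ₁ χ₂ t * deriv (deriv (rlInt (-α) u)) t
      = (gam α χ₂ - α) * (2 * χ₂ * t + χ₁) * deriv (rlInt (-α) u) t := by
  have hβ : -1 < -α := by linarith
  set j := rlInt (-α) u with hj
  have hu1 : RLSmooth fun s => s * u s := hu.smooth_mul contDiff_id
  have hu2 : RLSmooth fun s => s * (s * u s) := hu1.smooth_mul contDiff_id
  have hu' : RLSmooth fun s => tau χ₁ χ₂ s * deriv u s :=
    ⟨(contDiff_tau χ₁ χ₂).contDiffOn.mul (contDiffOn_deriv hu.1), hτ⟩
  have hv : RLSmooth fun s => (2 * χ₂ * s + χ₁) * u s :=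
    hu.smooth_mul (by fun_prop)
  have hw' := hv.add hu'
  have hJ1 : ∀ s, 0 < s → HasDerivAt (rlInt (-α) fun s => s * u s) (s * deriv j s + α * j s) s :=
    fun s hs => (hu.hasDerivAt_rlInt_id_mul hβ hs).congr_deriv (by rw [hj]; ring)
  set j1 := rlInt (-α) fun s => s * u s with hj1
  have hJ2 : ∀ s, 0 < s → HasDerivAt (rlInt (-α) fun s => s * (s * u s))
      (s * (s * deriv j s + α * j s) + α * j1 s) s :=
    fun s hs => (hu1.hasDerivAt_rlInt_id_mul hβ hs).congr_deriv (by
      rw [← hj1, (hJ1 s hs).deriv]; ring)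
  have hprim : ∀ s, 0 < s → ∫ r in (0 : ℝ)..s, ((2 * χ₂ * r + χ₁) * u r + tau χ₁ χ₂ r * deriv u r)
      = tau χ₁ χ₂ s * u s := fun s hs =>
    primitive_eq_of_linear_bound (C := |χ₂| + |χ₁|) (fun r hr => by
      unfold tau
      calc |χ₂ * r ^ 2 + χ₁ * r| ≤ |χ₂| * r ^ 2 + |χ₁| * r := by
            refine (abs_add_le _ _).trans (le_of_eq ?_)
            rw [abs_mul, abs_mul, abs_of_pos hr.1, abs_of_nonneg (sq_nonneg r)]
        _ ≤ |χ₂| * r + |χ₁| * r := by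
            gcongr
            nlinarith [hr.1, hr.2]
        _ = _ := by ring) hu.2 hw' (fun r hr =>
          (hasDerivAt_tau χ₁ χ₂ r).mul (hasDerivAt_of_contDiffOn hu.1 hr)) hs
  have hw : ∀ s, 0 < s → rlInt (-α) (fun s => ∫ r in (0 : ℝ)..s,
      ((2 * χ₂ * r + χ₁) * u r + tau χ₁ χ₂ r * deriv u r)) s =
      χ₂ * rlInt (-α) (fun s => s * (s * u s)) s + χ₁ * j1 s := fun s hs => by
    rw [rlInt_congr hs.le (g := fun s => χ₂ * (s * (s * u s)) + χ₁ * (s * u s)) fun r hr => by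
      rw [hprim r hr.1, tau]; ring, rlInt_add hβ (hu2.const_mul _) (hu1.const_mul _) hs,
      rlInt_const_mul, rlInt_const_mul]
  have hJw' : ∀ s, 0 < s → rlInt (-α)
      (fun r => (2 * χ₂ * r + χ₁) * u r + tau χ₁ χ₂ r * deriv u r) s =
      χ₂ * (s * (s * deriv j s + α * j s) + α * j1 s) + χ₁ * (s * deriv j s + α * j s) :=
    fun s hs => by
      refine (hw'.hasDerivAt_rlInt_primitive hβ hs).unique ?_
      refine (((hJ2 s hs).const_mul χ₂).add ((hJ1 s hs).const_mul χ₁)).congr_of_eventuallyEq ?_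
      filter_upwards [Ioi_mem_nhds hs] with r hr using hw r hr
  have hJv : ∀ s, 0 < s → rlInt (-α) (fun r => (2 * χ₂ * r + χ₁) * u r) s =
      2 * χ₂ * j1 s + χ₁ * j s := fun s hs => by
    rw [hj, hj1, ← rlInt_const_mul, ← rlInt_const_mul,
      ← rlInt_add hβ (hu1.const_mul _) (hu.const_mul _) hs]
    exact rlInt_congr hs.le fun r _ => by ring
  have hJu' : ∀ s, 0 < s → rlInt (-α) (fun r => tau χ₁ χ₂ r * deriv u r) s =
      χ₂ * (s * (s * deriv j s + α * j s) + α * j1 s) + χ₁ * (s * deriv j s + α * j s)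
        - (2 * χ₂ * j1 s + χ₁ * j s) := fun s hs => by
    rw [← hJw' s hs, ← hJv s hs, rlInt_add hβ hv hu' hs]
    ring
  have hjt : HasDerivAt j (deriv j t) t := (hu.differentiableAt_rlInt hβ ht).hasDerivAt
  have hjt' : HasDerivAt (deriv j) (deriv (deriv j) t) t :=
    hasDerivAt_of_contDiffOn (contDiffOn_deriv fun s hs =>
      (hu.contDiffAt_rlInt hβ hs).contDiffWithinAt) ht
  have hd := ((hasDerivAt_id t).mul hjt').add (hjt.const_mul α)
  have e1 := (((hJ1 t ht).const_mul (2 * χ₂)).add (hjt.const_mul χ₁)).congr_of_eventuallyEq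
    (f₁ := rlInt (-α) fun s => (2 * χ₂ * s + χ₁) * u s)
    (by filter_upwards [Ioi_mem_nhds ht] with s hs using hJv s hs)
  have e2 := ((((((hasDerivAt_id t).mul hd).add ((hJ1 t ht).const_mul α)).const_mul χ₂).add
    (hd.const_mul χ₁)).sub (((hJ1 t ht).const_mul (2 * χ₂)).add
      (hjt.const_mul χ₁))).congr_of_eventuallyEq
    (f₁ := rlInt (-α) fun s => tau χ₁ χ₂ s * deriv u s)
    (by filter_upwards [Ioi_mem_nhds ht] with s hs using hJu' s hs)
  rw [e1.deriv, e2.deriv]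
  simp only [id, tau, Pi.add_apply, Pi.mul_apply]
  linear_combination (α * j t) * gam_mul α χ₂

/-! ### The Riemann–Liouville derivative -/

theorem ceil_eq_one {α : ℝ} (h0 : 0 < α) (h1 : α < 1) : ⌈α⌉₊ = 1 := by
  rw [Nat.ceil_eq_iff one_ne_zero]
  constructor <;> norm_num <;> linarith

theorem rlDeriv_eq {α : ℝ} (h0 : 0 < α) (h1 : α < 1) (f : ℝ → ℝ) (t : ℝ) :
    rlDeriv α f t = (Real.Gamma (1 - α))⁻¹ * deriv (rlInt (-α) f) t := by
  have : α ≠ ((1 : ℕ) : ℝ) := by norm_num; linarith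
  rw [rlDeriv, ceil_eq_one h0 h1, if_neg this, iteratedDeriv_one]
  rw [Nat.cast_one, show (1 : ℝ) - α - 1 = -α by ring]
  rfl

/-- Orders `α` and `α + 1` share one kernel, since `⌈α + 1⌉ - (α + 1) = 1 - α`. -/
theorem rlDeriv_add_one_eq {α : ℝ} (h0 : 0 < α) (h1 : α < 1) (f : ℝ → ℝ) (t : ℝ) :
    rlDeriv (α + 1) f t = (Real.Gamma (1 - α))⁻¹ * deriv (deriv (rlInt (-α) f)) t := by
  have hc : ⌈α + 1⌉₊ = 2 := by rw [Nat.ceil_add_one h0.le, ceil_eq_one h0 h1]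
  have : α + 1 ≠ ((2 : ℕ) : ℝ) := by norm_num; linarith
  rw [rlDeriv, hc, if_neg this, iteratedDeriv_succ, iteratedDeriv_one,
    show ((2 : ℕ) : ℝ) - (α + 1) = 1 - α by push_cast; ring, show (1 : ℝ) - α - 1 = -α by ring]
  rfl

theorem rlDeriv_add {α : ℝ} (h0 : 0 < α) (h1 : α < 1) {f g : ℝ → ℝ} (hf : RLSmooth f)
    (hg : RLSmooth g) {t : ℝ} (ht : 0 < t) :
    rlDeriv α (fun s => f s + g s) t = rlDeriv α f t + rlDeriv α g t := by
  have hβ : -1 < -α := by linarith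
  rw [rlDeriv_eq h0 h1, rlDeriv_eq h0 h1, rlDeriv_eq h0 h1, ← mul_add]
  congr 1
  refine (((hf.differentiableAt_rlInt hβ ht).hasDerivAt.add
    (hg.differentiableAt_rlInt hβ ht).hasDerivAt).congr_of_eventuallyEq ?_).deriv
  filter_upwards [Ioi_mem_nhds ht] with s hs
  exact rlInt_add hβ hf hg hs

theorem rlDeriv_const_mul {α : ℝ} (h0 : 0 < α) (h1 : α < 1) (c : ℝ) (f : ℝ → ℝ) (t : ℝ) :
    rlDeriv α (fun s => c * f s) t = c * rlDeriv α f t := by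
  rw [rlDeriv_eq h0 h1, rlDeriv_eq h0 h1, funext (rlInt_const_mul (-α) c f), deriv_const_mul_field]
  ring

theorem rlDeriv_zero {α : ℝ} (h0 : 0 < α) (h1 : α < 1) (t : ℝ) : rlDeriv α (fun _ => 0) t = 0 := by
  simpa using rlDeriv_const_mul h0 h1 0 (fun _ => 0) t

theorem rlDeriv_sub {α : ℝ} (h0 : 0 < α) (h1 : α < 1) {f g : ℝ → ℝ} (hf : RLSmooth f)
    (hg : RLSmooth g) {t : ℝ} (ht : 0 < t) :
    rlDeriv α (fun s => f s - g s) t = rlDeriv α f t - rlDeriv α g t := by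
  have h := rlDeriv_add h0 h1 hf (hg.const_mul (-1)) ht
  rw [rlDeriv_const_mul h0 h1] at h
  simpa only [neg_one_mul, ← sub_eq_add_neg] using h

theorem rlDeriv_sum {α : ℝ} (h0 : 0 < α) (h1 : α < 1) {ι : Type*} {F : Finset ι} {f : ι → ℝ → ℝ}
    (hf : ∀ i ∈ F, RLSmooth (f i)) {t : ℝ} (ht : 0 < t) :
    rlDeriv α (fun s => ∑ i ∈ F, f i s) t = ∑ i ∈ F, rlDeriv α (f i) t := by
  classical
  induction F using Finset.induction_on with
  | empty => simpa using rlDeriv_zero h0 h1 t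
  | insert a F ha ih =>
    have hF : ∀ i ∈ F, RLSmooth (f i) := fun i hi => hf i (by simp [hi])
    simp only [Finset.sum_insert ha]
    rw [rlDeriv_add h0 h1 (hf a (by simp)) (RLSmooth.sum hF) ht, ih hF]

/-- The generalized Leibniz rule for a quadratic `τ` with `τ(0) = 0`. -/
theorem RLSmooth.rlDeriv_tau {α : ℝ} (h0 : 0 < α) (h1 : α < 1) {u : ℝ → ℝ} (hu : RLSmooth u)
    {χ₁ χ₂ : ℝ} (hτ : RLIntegrable fun s => tau χ₁ χ₂ s * deriv u s) {t : ℝ} (ht : 0 < t) :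
    rlDeriv α (fun s => gam α χ₂ * (2 * χ₂ * s + χ₁) * u s) t
      - rlDeriv α (fun s => tau χ₁ χ₂ s * deriv u s) t
      + tau χ₁ χ₂ t * rlDeriv (α + 1) u t
      = (gam α χ₂ - α) * (2 * χ₂ * t + χ₁) * rlDeriv α u t := by
  simp only [mul_assoc (gam α χ₂)]
  rw [rlDeriv_const_mul h0 h1, rlDeriv_add_one_eq h0 h1]
  simp only [rlDeriv_eq h0 h1]
  linear_combination (Real.Gamma (1 - α))⁻¹ * hu.deriv_rlInt_tau h1 hτ ht

/-- There are smooth functions supported in `(0, t₀)` with prescribed fractional derivative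
at `t₀`. -/
theorem exists_rlDeriv_eq {α : ℝ} (h0 : 0 < α) (h1 : α < 1) {t₀ : ℝ} (ht₀ : 0 < t₀) (c : ℝ) :
    ∃ ψ : ℝ → ℝ, ContDiff ℝ ∞ ψ ∧ (∀ s ∉ Ioo (t₀ / 8) (t₀ / 2), ψ s = 0) ∧ rlDeriv α ψ t₀ = c := by
  let φ : ContDiffBump (t₀ / 4) := ⟨t₀ / 16, t₀ / 8, by linarith, by linarith⟩
  have hφ0 : ∀ s ∉ Ioo (t₀ / 8) (t₀ / 2), φ s = 0 := fun s hs => φ.zero_of_le_dist (by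
    change t₀ / 8 ≤ _
    by_contra! h
    rw [Real.dist_eq, abs_lt] at h
    exact hs ⟨by linarith [h.1], by linarith [h.2]⟩)
  -- The support ends before `t₀`, so one may differentiate under the integral; the result is `-α /
  -- Γ(1 - α)` times the integral of a nonnegative function, positive at `t₀ / 4`.
  have hne : rlDeriv α φ t₀ ≠ 0 := by
    rw [rlDeriv_eq h0 h1, (hasDerivAt_rlInt_of_support (-α) (half_pos ht₀) (half_lt_self ht₀)
      (fun s hs => hφ0 s fun h => hs ⟨by linarith [h.1], h.2.le⟩)
      φ.continuous.locallyIntegrable).deriv]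
    refine mul_ne_zero (inv_ne_zero (Real.Gamma_pos_of_pos (by linarith)).ne')
      (mul_ne_zero (by linarith) (ne_of_gt ?_))
    have hc : ContinuousOn (fun s => (t₀ - s) ^ (-α - 1) * φ s) (Icc 0 (t₀ / 2)) := by
      refine ContinuousOn.mul (fun s hs => ?_) φ.continuous.continuousOn
      exact ((continuousAt_const.sub continuousAt_id).rpow_const
        (Or.inl (sub_pos.2 (show s < t₀ by linarith [hs.2])).ne')).continuousWithinAt
    have hi : rlInt (-α - 1) φ t₀ = ∫ s in (0 : ℝ)..t₀ / 2, (t₀ - s) ^ (-α - 1) * φ s := by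
      have hz : EqOn (fun _ => (0 : ℝ)) (fun s => (t₀ - s) ^ (-α - 1) * φ s)
          (uIcc (t₀ / 2) t₀) := fun s hs => by
        rw [uIcc_of_le (by linarith)] at hs
        simp only [hφ0 s fun h => absurd h.2 (not_lt.2 hs.1), mul_zero]
      rw [rlInt, ← intervalIntegral.integral_add_adjacent_intervals (b := t₀ / 2)
        (ContinuousOn.intervalIntegrable_of_Icc (by linarith) hc)
        ((intervalIntegrable_const (c := (0 : ℝ))).congr
          (hz.mono uIoc_subset_uIcc)), ← intervalIntegral.integral_congr hz]
      simp
    rw [hi]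
    refine intervalIntegral.integral_pos (by linarith) hc (fun s hs => ?_)
      ⟨t₀ / 4, ⟨by linarith, by linarith⟩, ?_⟩
    · exact mul_nonneg (Real.rpow_nonneg (by linarith [hs.2]) _) φ.nonneg
    · exact mul_pos (Real.rpow_pos_of_pos (by linarith) _)
        (φ.pos_of_mem_ball (Metric.mem_ball_self φ.rOut_pos))
  refine ⟨fun s => c / rlDeriv α φ t₀ * φ s, contDiff_const.mul φ.contDiff,
    fun s hs => by simp [hφ0 s hs], ?_⟩
  rw [rlDeriv_const_mul h0 h1]
  exact div_mul_cancel₀ c hne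

/-! ### Smooth fields and right-hand sides -/

variable {p q k : ℕ}

theorem SmoothFld.component {u : Fld p q} (hu : SmoothFld u) (s : Fin q) :
    ContDiffOn ℝ ∞ (fun P : ℝ × (Fin p → ℝ) => u P.1 P.2 s) (Ioi 0 ×ˢ univ) :=
  contDiffOn_pi.1 hu s

theorem SmoothFld.time {u : Fld p q} (hu : SmoothFld u) (s : Fin q) (x : Fin p → ℝ) :
    ContDiffOn ℝ ∞ (fun r => u r x s) (Ioi 0) :=
  (hu.component s).comp (f := fun r : ℝ => (r, x)) (by fun_prop) fun _ hr => ⟨hr, mem_univ _⟩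

theorem SmoothFld.time_pd {u : Fld p q} (hu : SmoothFld u) (s : Fin q) (i : Fin p)
    (x : Fin p → ℝ) : ContDiffOn ℝ ∞ (fun r => pd i (fun y => u r y s) x) (Ioi 0) := by
  have ho : IsOpen (Ioi (0 : ℝ) ×ˢ (univ : Set (Fin p → ℝ))) := isOpen_Ioi.prod isOpen_univ
  have h1 := (hu.component s).fderiv_of_isOpen ho (m := ∞) (by simp)
  have h2 : ContDiffOn ℝ ∞ (fun r : ℝ => fderiv ℝ (fun P : ℝ × (Fin p → ℝ) => u P.1 P.2 s)
      (r, x) (0, Pi.single i 1)) (Ioi 0) :=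
    (h1.comp (f := fun r : ℝ => (r, x)) (by fun_prop) fun _ hr => ⟨hr, mem_univ _⟩).clm_apply
      contDiffOn_const
  refine h2.congr fun r hr => ?_
  have hd : DifferentiableAt ℝ (fun P : ℝ × (Fin p → ℝ) => u P.1 P.2 s) (r, x) :=
    ((hu.component s).contDiffAt (ho.mem_nhds ⟨hr, mem_univ _⟩)).differentiableAt (by simp)
  rw [← hd.lineDeriv_eq_fderiv]
  simp [pd, lineDeriv]

theorem SmoothRhs.differentiableAt {E : Rhs p q k} (hE : SmoothRhs E) (s : Fin q) {t : ℝ}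
    (ht : 0 < t) (x : Fin p → ℝ) (z : Jet p q k) :
    DifferentiableAt ℝ (fun P : ℝ × (Fin p → ℝ) × Jet p q k => E P.1 P.2.1 P.2.2 s) (t, x, z) :=
  ((contDiffOn_pi.1 hE s).contDiffAt ((isOpen_Ioi.prod isOpen_univ).mem_nhds
    (show (t, x, z) ∈ Ioi 0 ×ˢ univ from ⟨ht, mem_univ _⟩))).differentiableAt (by simp)

theorem lineDeriv_sub_eq {V : Type*} [NormedAddCommGroup V] [NormedSpace ℝ V] {f g : V → ℝ} {y : V}
    (hf : DifferentiableAt ℝ f y) (hg : DifferentiableAt ℝ g y) (v : V) :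
    lineDeriv ℝ (fun w => f w - g w) y v = lineDeriv ℝ f y v - lineDeriv ℝ g y v := by
  rw [(hf.fun_sub hg).lineDeriv_eq_fderiv, hf.lineDeriv_eq_fderiv, hg.lineDeriv_eq_fderiv,
    fderiv_fun_sub hf hg]
  rfl

theorem SmoothRhs.deriv_partF {E : Rhs p q k} (hE : SmoothRhs E) (s : Fin q) {t : ℝ}
    (ht : 0 < t) (x : Fin p → ℝ) (z : Jet p q k) :
    deriv (fun r => partF E r x z s) t =
      deriv (fun r => E r x z s) t - deriv (fun r => partH E s r x) t :=
  deriv_fun_sub ((hE.differentiableAt s ht x z).comp t (f := fun r : ℝ => (r, x, z)) (by fun_prop))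
    ((hE.differentiableAt s ht x 0).comp t (f := fun r : ℝ => (r, x, (0 : Jet p q k)))
      (by fun_prop))

theorem SmoothRhs.pd_partF {E : Rhs p q k} (hE : SmoothRhs E) (s : Fin q) {t : ℝ}
    (ht : 0 < t) (x : Fin p → ℝ) (z : Jet p q k) (i : Fin p) :
    pd i (fun y => partF E t y z s) x =
      pd i (fun y => E t y z s) x - pd i (fun y => partH E s t y) x :=
  lineDeriv_sub_eq ((hE.differentiableAt s ht x z).comp x (f := fun y => (t, y, z)) (by fun_prop))
    ((hE.differentiableAt s ht x 0).comp x (f := fun y => (t, y, (0 : Jet p q k))) (by fun_prop)) _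

theorem SmoothRhs.jetPd_partF {E : Rhs p q k} (hE : SmoothRhs E) (s j : Fin q) (θ : MIdx p k)
    {t : ℝ} (ht : 0 < t) (x : Fin p → ℝ) (z : Jet p q k) :
    jetPd (partF E) s j θ t x z = jetPd E s j θ t x z := by
  have hF : DifferentiableAt ℝ (fun w => E t x w s) z :=
    (hE.differentiableAt s ht x z).comp z (f := fun w => (t, x, w)) (by fun_prop)
  unfold jetPd partF
  rw [lineDeriv_sub_eq hF (differentiableAt_const _)]
  simp [lineDeriv]

theorem SmoothRhs.jetPd_partN {E : Rhs p q k} (hE : SmoothRhs E) (s j : Fin q) (θ : MIdx p k)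
    {t : ℝ} (ht : 0 < t) (x : Fin p → ℝ) (z : Jet p q k) :
    jetPd (partN E) s j θ t x z = jetPd E s j θ t x z - linCoeff E s j θ t x := by
  have hF : DifferentiableAt ℝ (fun w => partF E t x w s) z :=
    ((hE.differentiableAt s ht x z).comp z (f := fun w => (t, x, w)) (by fun_prop)).sub_const _
  rw [← hE.jetPd_partF s j θ ht x z]
  unfold jetPd partN
  rw [lineDeriv_sub_eq hF (by fun_prop)]
  congr 1
  have : ∀ r : ℝ, ∑ j', ∑ θ' : MIdx p k, linCoeff E s j' θ' t x *
      (z + r • (Pi.single j (Pi.single θ 1) : Jet p q k)) j' θ' =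
      (∑ j', ∑ θ' : MIdx p k, linCoeff E s j' θ' t x * z j' θ') + r * linCoeff E s j θ t x := by
    intro r
    have h1 : ∑ j', ∑ θ' : MIdx p k, linCoeff E s j' θ' t x *
        (r * (Pi.single j (Pi.single θ 1) : Jet p q k) j' θ') = r * linCoeff E s j θ t x := by
      rw [Finset.sum_eq_single j, Finset.sum_eq_single θ]
      · simp [mul_comm]
      · intro b _ hb
        simp [hb]
      · simp
      · intro b _ hb
        simp [hb]
      · simp
    rw [← h1, ← Finset.sum_add_distrib]
    simp only [← Finset.sum_add_distrib]
    simp [mul_add]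
  simp only [lineDeriv, this]
  simp

/-! ### The prolongation of a generator of the special form -/

/-- The coefficients of the linear part of `η_s`. -/
def etaCoeff (α χ₁ χ₂ : ℝ) (g : Fin q → (Fin p → ℝ) → ℝ) (f : Fin q → Fin q → (Fin p → ℝ) → ℝ)
    (s i : Fin q) (t : ℝ) (x : Fin p → ℝ) : ℝ :=
  if i = s then g s x + gam α χ₂ * (2 * χ₂ * t + χ₁) else f s i x

theorem sum_etaCoeff (α χ₁ χ₂ : ℝ) (g : Fin q → (Fin p → ℝ) → ℝ)
    (f : Fin q → Fin q → (Fin p → ℝ) → ℝ) (s : Fin q) (t : ℝ) (x : Fin p → ℝ) (v : Fin q → ℝ) :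
    ∑ i, etaCoeff α χ₁ χ₂ g f s i t x * v i =
      (g s x + gam α χ₂ * (2 * χ₂ * t + χ₁)) * v s + ∑ i ∈ Finset.univ.erase s, f s i x * v i := by
  rw [← Finset.add_sum_erase _ _ (Finset.mem_univ s)]
  congr 1
  · simp [etaCoeff]
  · refine Finset.sum_congr rfl fun i hi => ?_
    simp [etaCoeff, Finset.ne_of_mem_erase hi]

variable {α χ₁ χ₂ : ℝ} {ξ : Fin p → (Fin p → ℝ) → ℝ} {g : Fin q → (Fin p → ℝ) → ℝ}
  {f : Fin q → Fin q → (Fin p → ℝ) → ℝ} {h : Fld p q} {E : Rhs p q k}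

theorem etaU_specialGen (s i : Fin q) (t : ℝ) (x : Fin p → ℝ) (v : Fin q → ℝ) :
    etaU (specialGen α χ₁ χ₂ ξ g f h) s i t x v = etaCoeff α χ₁ χ₂ g f s i t x := by
  have h1 : ∀ w, (specialGen α χ₁ χ₂ ξ g f h).η s t x w =
      ∑ i, etaCoeff α χ₁ χ₂ g f s i t x * w i + h t x s := fun w => by
    rw [sum_etaCoeff]
    rfl
  have h2 : ∀ r : ℝ, ∑ j, etaCoeff α χ₁ χ₂ g f s j t x * (v + r • (Pi.single i 1 : Fin q → ℝ)) j
      = ∑ j, etaCoeff α χ₁ χ₂ g f s j t x * v j + r * etaCoeff α χ₁ χ₂ g f s i t x := fun r => by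
    simp [mul_add, Finset.sum_add_distrib, Pi.single_apply, mul_comm]
  simp only [etaU, pd, lineDeriv, h1, h2]
  simp

theorem charac_specialGen (u : Fld p q) (s : Fin q) (t : ℝ) (x : Fin p → ℝ) :
    charac (specialGen α χ₁ χ₂ ξ g f h) u s t x =
      (((g s x * u t x s + gam α χ₂ * (2 * χ₂ * t + χ₁) * u t x s)
        + ∑ i ∈ Finset.univ.erase s, f s i x * u t x i) + h t x s)
        - tau χ₁ χ₂ t * deriv (fun r => u r x s) t
        - ∑ i, ξ i x * pd i (fun y => u t y s) x := by
  simp only [charac, specialGen]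
  ring

/-- The `ξ_i` do not depend on `t`, so they pass through `∂_t^α` and their terms cancel;
`RLSmooth.rlDeriv_tau` collapses those with `τ` and `γ`. -/
theorem etaAlpha_specialGen (h0 : 0 < α) (h1 : α < 1) (hh : SmoothFld h)
    (hh_int : ∀ s x, RLIntegrable fun t => h t x s) {u : Fld p q}
    (hu : Admissible (specialGen α χ₁ χ₂ ξ g f h) u) (s : Fin q) {t : ℝ} (ht : 0 < t)
    (x : Fin p → ℝ) :
    etaAlpha α (specialGen α χ₁ χ₂ ξ g f h) u s t x =
      ∑ i, etaCoeff α χ₁ χ₂ g f s i t x * rlDeriv α (fun r => u r x i) t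
        - α * (2 * χ₂ * t + χ₁) * rlDeriv α (fun r => u r x s) t
        + rlDeriv α (fun r => h r x s) t := by
  have hU : ∀ i, RLSmooth fun r => u r x i := fun i => ⟨hu.1.time i x, (hu.2 i x).1⟩
  have hP : ∀ i, RLSmooth fun r => pd i (fun y => u r y s) x :=
    fun i => ⟨hu.1.time_pd s i x, (hu.2 s x).2.1 i⟩
  have hH : RLSmooth fun r => h r x s := ⟨hh.time s x, hh_int s x⟩
  have a1 := (hU s).const_mul (g s x)
  have a2 : RLSmooth fun r => gam α χ₂ * (2 * χ₂ * r + χ₁) * u r x s :=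
    (hU s).smooth_mul (by fun_prop)
  have a3 : RLSmooth fun r => ∑ i ∈ Finset.univ.erase s, f s i x * u r x i :=
    RLSmooth.sum fun i _ => (hU i).const_mul _
  have a4 : RLSmooth fun r => ∑ i, ξ i x * pd i (fun y => u r y s) x :=
    RLSmooth.sum fun i _ => (hP i).const_mul _
  have a5 := ((a1.add a2).add a3).add hH
  -- Admissibility does not mention `τ ∂_t u_s`, but this is the difference between the other terms
  -- of the characteristic and the characteristic itself, all integrable.
  have hτ : RLIntegrable fun r => tau χ₁ χ₂ r * deriv (fun r => u r x s) r := fun T hT => by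
    have := ((a5.2 T hT).sub (a4.2 T hT)).sub ((hu.2 s x).2.2 T hT)
    refine this.congr fun r _ => ?_
    simp only [charac_specialGen]
    ring
  have a6 : RLSmooth fun r => tau χ₁ χ₂ r * deriv (fun r => u r x s) r :=
    ⟨(contDiff_tau χ₁ χ₂).contDiffOn.mul (contDiffOn_deriv (hU s).1), hτ⟩
  have key := (hU s).rlDeriv_tau h0 h1 hτ ht
  have hc : rlDeriv α (fun r => charac (specialGen α χ₁ χ₂ ξ g f h) u s r x) t =
      (((g s x * rlDeriv α (fun r => u r x s) t
        + rlDeriv α (fun r => gam α χ₂ * (2 * χ₂ * r + χ₁) * u r x s) t)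
        + ∑ i ∈ Finset.univ.erase s, f s i x * rlDeriv α (fun r => u r x i) t)
        + rlDeriv α (fun r => h r x s) t)
        - rlDeriv α (fun r => tau χ₁ χ₂ r * deriv (fun r => u r x s) r) t
        - ∑ i, ξ i x * rlDeriv α (fun r => pd i (fun y => u r y s) x) t := by
    simp only [charac_specialGen]
    rw [rlDeriv_sub h0 h1 (a5.sub a6) a4 ht, rlDeriv_sub h0 h1 a5 a6 ht,
      rlDeriv_add h0 h1 ((a1.add a2).add a3) hH ht, rlDeriv_add h0 h1 (a1.add a2) a3 ht,
      rlDeriv_add h0 h1 a1 a2 ht, rlDeriv_const_mul h0 h1,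
      rlDeriv_sum h0 h1 (fun i _ => (hU i).const_mul _) ht,
      rlDeriv_sum h0 h1 (fun i _ => (hP i).const_mul _) ht]
    simp only [rlDeriv_const_mul h0 h1]
  rw [etaAlpha, hc, sum_etaCoeff]
  simp only [specialGen]
  linear_combination key

/-- The left-hand side of the linear time-fractional determining system. -/
def fracExpr (α : ℝ) (E : Rhs p q k) (χ₁ χ₂ : ℝ)
    (ξ : Fin p → (Fin p → ℝ) → ℝ) (g : Fin q → (Fin p → ℝ) → ℝ)
    (f : Fin q → Fin q → (Fin p → ℝ) → ℝ) (h : Fld p q) (s : Fin q) (t : ℝ) (x : Fin p → ℝ)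
    (v : Fin q → ℝ) : ℝ :=
  rlDeriv α (fun r => h r x s) t
      + ∑ i, etaU (specialGen α χ₁ χ₂ ξ g f h) s i t x v * partH E i t x
      - α * deriv (tau χ₁ χ₂) t * partH E s t x
      - tau χ₁ χ₂ t * deriv (fun r => partH E s r x) t
      - ∑ i, ξ i x * pd i (fun y => partH E s t y) x
      - ∑ j, ∑ θ : MIdx p k, uTheta h j θ.toNat t x * linCoeff E s j θ t x

/-- The left-hand side of the integer-order determining system. -/
def intExpr (α : ℝ) (E : Rhs p q k) (χ₁ χ₂ : ℝ)
    (ξ : Fin p → (Fin p → ℝ) → ℝ) (g : Fin q → (Fin p → ℝ) → ℝ)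
    (f : Fin q → Fin q → (Fin p → ℝ) → ℝ) (h u : Fld p q) (s : Fin q) (t : ℝ)
    (x : Fin p → ℝ) : ℝ :=
  ∑ i, etaU (specialGen α χ₁ χ₂ ξ g f h) s i t x (u t x) * partF E t x (jet k u t x) i
      - α * deriv (tau χ₁ χ₂) t * partF E t x (jet k u t x) s
      - tau χ₁ χ₂ t * deriv (fun r => partF E r x (jet k u t x) s) t
      - ∑ i, ξ i x * pd i (fun y => partF E t y (jet k u t x) s) x
      - ∑ j, ∑ θ : MIdx p k,
          (etaTheta (specialGen α χ₁ χ₂ ξ g f h) u j θ.toNat t x - uTheta h j θ.toNat t x)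
            * linCoeff E s j θ t x
      - ∑ j, ∑ θ : MIdx p k,
          etaTheta (specialGen α χ₁ χ₂ ξ g f h) u j θ.toNat t x
            * jetPd (partN E) s j θ t x (jet k u t x)

/-- The vector `v` is free because `η_s` is affine in `u`. In the jet sum, `∂E_s/∂u_j^θ` splits into
`a_{s,j,θ}` and the derivative of `N_s`, and `∂_x^θ h_j` is separated from `η_j^θ` in the part with
`a_{s,j,θ}`. -/
theorem prolong_specialGen (h0 : 0 < α) (h1 : α < 1) (hE : SmoothRhs E) (hh : SmoothFld h)
    (hh_int : ∀ s x, RLIntegrable fun t => h t x s) {u : Fld p q}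
    (hu : Admissible (specialGen α χ₁ χ₂ ξ g f h) u) {t : ℝ} (ht : 0 < t) (x : Fin p → ℝ)
    (heq : ∀ s, rlDeriv α (fun r => u r x s) t = E t x (jet k u t x) s) (s : Fin q)
    (v : Fin q → ℝ) :
    prolong α E (specialGen α χ₁ χ₂ ξ g f h) u s t x =
      fracExpr α E χ₁ χ₂ ξ g f h s t x v + intExpr α E χ₁ χ₂ ξ g f h u s t x := by
  have e1 : ∑ i, etaCoeff α χ₁ χ₂ g f s i t x * E t x (jet k u t x) i =
      ∑ i, etaCoeff α χ₁ χ₂ g f s i t x * partH E i t x +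
      ∑ i, etaCoeff α χ₁ χ₂ g f s i t x * partF E t x (jet k u t x) i := by
    rw [← Finset.sum_add_distrib]
    exact Finset.sum_congr rfl fun i _ => by rw [partF]; ring
  have e2 : ∑ i, ξ i x * pd i (fun y => E t y (jet k u t x) s) x =
      ∑ i, ξ i x * pd i (fun y => partH E s t y) x +
      ∑ i, ξ i x * pd i (fun y => partF E t y (jet k u t x) s) x := by
    rw [← Finset.sum_add_distrib]
    exact Finset.sum_congr rfl fun i _ => by rw [hE.pd_partF s ht]; ring
  have e3 : ∑ j, ∑ θ : MIdx p k, etaTheta (specialGen α χ₁ χ₂ ξ g f h) u j θ.toNat t x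
        * jetPd E s j θ t x (jet k u t x) =
      (∑ j, ∑ θ : MIdx p k, uTheta h j θ.toNat t x * linCoeff E s j θ t x) +
      (∑ j, ∑ θ : MIdx p k,
          (etaTheta (specialGen α χ₁ χ₂ ξ g f h) u j θ.toNat t x - uTheta h j θ.toNat t x)
            * linCoeff E s j θ t x) +
      ∑ j, ∑ θ : MIdx p k,
          etaTheta (specialGen α χ₁ χ₂ ξ g f h) u j θ.toNat t x
            * jetPd (partN E) s j θ t x (jet k u t x) := by
    simp only [← Finset.sum_add_distrib]
    refine Finset.sum_congr rfl fun j _ => Finset.sum_congr rfl fun θ _ => ?_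
    rw [hE.jetPd_partN s j θ ht]
    ring
  rw [prolong, etaAlpha_specialGen h0 h1 hh hh_int hu s ht x, e3]
  simp only [fracExpr, intExpr, etaU_specialGen, deriv_tau, heq, hE.deriv_partF s ht]
  rw [e1]
  have e4 : partF E t x (jet k u t x) s = E t x (jet k u t x) s - partH E s t x := rfl
  have e5 : (specialGen α χ₁ χ₂ ξ g f h).τ t x (u t x) = tau χ₁ χ₂ t := rfl
  have e6 : ∀ i, (specialGen α χ₁ χ₂ ξ g f h).ξ i t x (u t x) = ξ i x := fun _ => rfl
  simp only [e4, e5, e6]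
  rw [e2]
  ring

/-! ### The two determining conditions -/

theorem pdMulti_zero (θ : Fin p → ℕ) : pdMulti θ (fun _ => 0) = fun _ => 0 := by
  have h1 : ∀ i : Fin p, pd i (fun _ => 0) = fun _ => 0 := fun i => by
    ext y
    simp [pd, lineDeriv]
  have h2 : ∀ l : List (Fin p), l.foldr (fun i F => (pd i)^[θ i] F) (fun _ => 0) = fun _ => 0 := by
    intro l
    induction l with
    | nil => rfl
    | cons a l ih =>
      rw [List.foldr_cons, ih]
      exact Function.iterate_fixed (h1 a) _
  exact h2 _

theorem uTheta_zero (s : Fin q) (θ : Fin p → ℕ) (t : ℝ) (x : Fin p → ℝ) :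
    uTheta (fun _ _ _ => 0 : Fld p q) s θ t x = 0 := by
  rw [uTheta, pdMulti_zero]

theorem etaTheta_specialGen_zero (s : Fin q) (θ : Fin p → ℕ) (t : ℝ) (x : Fin p → ℝ) :
    etaTheta (specialGen α χ₁ χ₂ ξ g f h) (fun _ _ _ => 0) s θ t x = uTheta h s θ t x := by
  simp [etaTheta, uTheta_zero, charac_specialGen, pd, lineDeriv]
  rfl

/-- At `u = 0` the prolonged coefficients reduce to `∂_x^θ h_j`, `F` vanishes for all `(t, x)`, and
`N` has no linear part. -/
theorem intExpr_zero (hE : SmoothRhs E) (s : Fin q) {t : ℝ} (ht : 0 < t) (x : Fin p → ℝ) :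
    intExpr α E χ₁ χ₂ ξ g f h (fun _ _ _ => 0) s t x = 0 := by
  have hj : jet k (fun _ _ _ => 0 : Fld p q) t x = 0 := by
    ext j θ
    exact uTheta_zero j _ t x
  have hF : ∀ r y i, partF E r y 0 i = 0 := fun r y i => sub_self _
  have hN : ∀ j θ, jetPd (partN E) s j θ t x 0 = 0 := fun j θ => by
    rw [hE.jetPd_partN s j θ ht, linCoeff, hE.jetPd_partF s j θ ht, sub_self]
  simp [intExpr, hj, hF, hN, etaTheta_specialGen_zero, pd, lineDeriv]

/-- Agreement near `t`, not just at `t`, is required because the characteristic contains `∂_t u_s`.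
-/
theorem charac_congr {X : Generator p q} {u w : Fld p q} {t : ℝ} (hw : ∀ᶠ r in 𝓝 t, w r = u r)
    (s : Fin q) (y : Fin p → ℝ) : charac X w s t y = charac X u s t y := by
  have h1 : (fun r => w r y s) =ᶠ[𝓝 t] fun r => u r y s := hw.mono fun r hr => by simp only [hr]
  rw [charac, charac, hw.self_of_nhds, h1.deriv_eq]

theorem etaTheta_congr {X : Generator p q} {u w : Fld p q} {t : ℝ} (hw : ∀ᶠ r in 𝓝 t, w r = u r)
    (s : Fin q) (θ : Fin p → ℕ) (x : Fin p → ℝ) : etaTheta X w s θ t x = etaTheta X u s θ t x := by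
  have h1 : (fun r => uTheta w s θ r x) =ᶠ[𝓝 t] fun r => uTheta u s θ r x :=
    hw.mono fun r hr => by simp only [uTheta, hr]
  simp only [etaTheta, charac_congr hw, h1.deriv_eq]
  simp only [uTheta, hw.self_of_nhds]

theorem jet_congr {u w : Fld p q} {t : ℝ} (hw : w t = u t) (x : Fin p → ℝ) :
    jet k w t x = jet k u t x := by
  unfold jet uTheta
  rw [hw]

theorem intExpr_congr {u w : Fld p q} {t : ℝ} (hw : ∀ᶠ r in 𝓝 t, w r = u r) (s : Fin q)
    (x : Fin p → ℝ) :
    intExpr α E χ₁ χ₂ ξ g f h w s t x = intExpr α E χ₁ χ₂ ξ g f h u s t x := by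
  simp only [intExpr, jet_congr hw.self_of_nhds, etaTheta_congr hw, hw.self_of_nhds]

theorem admissible_of_eq_zero_near (hh : SmoothFld h)
    (hh_int : ∀ s x, RLIntegrable fun t => h t x s) {u : Fld p q} (hu : SmoothFld u) {ε : ℝ}
    (hε : 0 < ε) (h0 : ∀ r ∈ Ioc 0 ε, u r = fun _ _ => 0) :
    Admissible (specialGen α χ₁ χ₂ ξ g f h) u := by
  have hU : ∀ s x, RLSmooth fun r => u r x s := fun s x =>
    .of_eq_zero_near (hu.time s x) hε fun r hr => by rw [h0 r hr]
  have hP : ∀ s x i, RLSmooth fun r => pd i (fun y => u r y s) x := fun s x i =>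
    .of_eq_zero_near (hu.time_pd s i x) hε fun r hr => by simp [h0 r hr, pd, lineDeriv]
  have hD : ∀ s x, RLSmooth (deriv fun r => u r x s) := fun s x => by
    refine .of_eq_zero_near (contDiffOn_deriv (hu.time s x)) (half_pos hε) fun r hr => ?_
    have : (fun r => u r x s) =ᶠ[𝓝 r] fun _ => 0 := by
      filter_upwards [Ioo_mem_nhds hr.1 (lt_of_le_of_lt hr.2 (half_lt_self hε))] with a ha
      rw [h0 a ⟨ha.1, ha.2.le⟩]
    rw [this.deriv_eq, deriv_const]
  refine ⟨hu, fun s x => ⟨(hU s x).2, fun i => (hP s x i).2, ?_⟩⟩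
  have hH : RLSmooth fun r => h r x s := ⟨hh.time s x, hh_int s x⟩
  have a2 : RLSmooth fun r => gam α χ₂ * (2 * χ₂ * r + χ₁) * u r x s :=
    (hU s x).smooth_mul (by fun_prop)
  simp only [charac_specialGen]
  exact ((((((hU s x).const_mul (g s x)).add a2).add
    (RLSmooth.sum fun i _ => (hU i x).const_mul _)).add hH).sub
    ((hD s x).smooth_mul (contDiff_tau χ₁ χ₂))).sub
    (RLSmooth.sum fun i _ => (hP s x i).const_mul _) |>.2

/-- Every point of the jet space is represented by an admissible function which satisfies the
system at that point. -/
theorem exists_admissible_solution_at (h0 : 0 < α) (h1 : α < 1) (hh : SmoothFld h)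
    (hh_int : ∀ s x, RLIntegrable fun t => h t x s) {u : Fld p q} (hu : SmoothFld u) {t₀ : ℝ}
    (ht₀ : 0 < t₀) (x₀ : Fin p → ℝ) :
    ∃ w : Fld p q, Admissible (specialGen α χ₁ χ₂ ξ g f h) w ∧ (∀ᶠ r in 𝓝 t₀, w r = u r) ∧
      ∀ s, rlDeriv α (fun r => w r x₀ s) t₀ = E t₀ x₀ (jet k w t₀ x₀) s := by
  -- The given `u` need not be integrable at `0`; the factor `φ` removes it there and equals `1`
  -- around `t₀`.
  obtain ⟨φ, hφ, -, hφ1, hφ0⟩ := exists_cutoff (contDiffOn_const (c := (1 : ℝ)))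
    (show 0 < t₀ / 2 by linarith) (show t₀ / 2 < 2 * t₀ by linarith)
  -- Each `ψ s` depends on time only and is supported before `t₀ / 2`: it leaves the jet at `t₀`,
  -- hence the target value of `E`, unchanged while correcting the fractional derivative.
  have hψ := fun s => exists_rlDeriv_eq h0 h1 ht₀
    (E t₀ x₀ (jet k u t₀ x₀) s - rlDeriv α (fun r => φ r * u r x₀ s) t₀)
  choose ψ hψ hψ0 hψ1 using hψ
  have hwu : ∀ᶠ r in 𝓝 t₀, (fun x s => φ r * u r x s + ψ s r) = u r := by
    filter_upwards [Ioo_mem_nhds (half_lt_self ht₀) (show t₀ < 2 * t₀ by linarith)] with r hr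
    ext x s
    rw [hφ1 ⟨hr.1.le, hr.2.le⟩, hψ0 s r fun h => absurd h.2 (not_lt.2 hr.1.le)]
    ring
  refine ⟨fun r x s => φ r * u r x s + ψ s r, ?_, hwu, fun s => ?_⟩
  · refine admissible_of_eq_zero_near hh hh_int ?_ (show 0 < t₀ / 8 by linarith) fun r hr => ?_
    · refine contDiffOn_pi.2 fun s => ?_
      exact ((hφ.comp contDiff_fst).contDiffOn.mul (hu.component s)).add
        ((hψ s).comp contDiff_fst).contDiffOn
    · ext x s
      rw [hφ0 r (by linarith [hr.2]), hψ0 s r fun h => absurd h.1 (not_lt.2 hr.2)]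
      ring
  · rw [jet_congr hwu.self_of_nhds]
    have a1 : RLSmooth fun r => φ r * u r x₀ s :=
      .of_eq_zero_near (hφ.contDiffOn.mul (hu.time s x₀)) (show 0 < t₀ / 4 by linarith)
        fun r hr => by rw [hφ0 r (by linarith [hr.2]), zero_mul]
    rw [rlDeriv_add h0 h1 a1 (.of_contDiff (hψ s)) ht₀, hψ1 s]
    ring

end FracLie

end

/-- Lie symmetries of `∂_t^α u = F(t, x, u^{(k)}) + H(t, x)`, among the generators of the special
form, are exactly the solutions of the two determining conditions. -/
theorem mainTheorem3 (p q k : ℕ) (α : ℝ) (hα0 : 0 < α) (hα1 : α < 1)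
    (E : FracLie.Rhs p q k) (hE : FracLie.SmoothRhs E)
    (χ₁ χ₂ : ℝ)
    (ξ : Fin p → (Fin p → ℝ) → ℝ) (hξ : ∀ i, ContDiff ℝ ∞ (ξ i))
    (g : Fin q → (Fin p → ℝ) → ℝ) (hg : ∀ s, ContDiff ℝ ∞ (g s))
    (f : Fin q → Fin q → (Fin p → ℝ) → ℝ) (hf : ∀ s i, ContDiff ℝ ∞ (f s i))
    (h : FracLie.Fld p q) (hh : FracLie.SmoothFld h)
    (hh_int : ∀ s x, FracLie.RLIntegrable (fun t => h t x s)) :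
    FracLie.IsLieSymmetry α E (FracLie.specialGen α χ₁ χ₂ ξ g f h) ↔
      FracLie.FractionalCondition α E χ₁ χ₂ ξ g f h ∧
      FracLie.IntegerOrderCondition α E χ₁ χ₂ ξ g f h := by
  constructor
  · rintro ⟨-, hsym⟩
    have key : ∀ u : FracLie.Fld p q, FracLie.SmoothFld u → ∀ s t x v, 0 < t →
        FracLie.fracExpr α E χ₁ χ₂ ξ g f h s t x v
          + FracLie.intExpr α E χ₁ χ₂ ξ g f h u s t x = 0 := by
      intro u hu s t x v ht
      obtain ⟨w, hw, hwu, heq⟩ := FracLie.exists_admissible_solution_at (E := E) (χ₁ := χ₁)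
        (χ₂ := χ₂) (ξ := ξ) (g := g) (f := f) hα0 hα1 hh hh_int hu ht x
      rw [← FracLie.intExpr_congr hwu s x, ← FracLie.prolong_specialGen hα0 hα1 hE hh hh_int hw ht x
        heq s v]
      exact hsym w hw t x ht heq s
    have hfrac : ∀ s t x v, 0 < t → FracLie.fracExpr α E χ₁ χ₂ ξ g f h s t x v = 0 := by
      intro s t x v ht
      -- The zero function isolates the part that is independent of `u`.
      have := key (fun _ _ _ => 0) contDiffOn_const s t x v ht
      rwa [FracLie.intExpr_zero hE s ht, add_zero] at this
    refine ⟨hfrac, fun u hu s t x ht => ?_⟩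
    have := key u hu s t x 0 ht
    rwa [hfrac s t x 0 ht, zero_add] at this
  · rintro ⟨hfrac, hint⟩
    refine ⟨fun _ _ => by simp [FracLie.specialGen, FracLie.tau], fun u hu t x ht heq s => ?_⟩
    rw [FracLie.prolong_specialGen hα0 hα1 hE hh hh_int hu ht x heq s 0]
    have e1 : FracLie.fracExpr α E χ₁ χ₂ ξ g f h s t x 0 = 0 := hfrac s t x 0 ht
    have e2 : FracLie.intExpr α E χ₁ χ₂ ξ g f h u s t x = 0 := hint u hu.1 s t x ht
    rw [e1, e2, add_zero]
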